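/- **System.** Let $N\ge 2$, $K=2$. A library consists of $N$ independent files $F_1,\dots,F_N$ of $B$ i.i.d. uniform bits each. *Placement:* user $k\in\{1,2\}$ gets random cache metadata $\mathscr M(C_k)$ and stores $Z_k=(\mathscr M(C_k),C_k)$, where $C_k$ is a function of $\mathscr M(C_k)$ and the library; $(\mathscr M(C_1),\mathscr M(C_2))$ is independent of the files and of the demands. The placement is *uncoded* if $C_k$ is a list of directly copied library bits, at positions determined by $\mathscr M(C_k)$. *Delivery:* user $k$ demands the file with index $D_k$, where $\mathbf D=(D_1,D_2)$ is a random vector in $\{1,\dots,N\}^2$ of a fixed law under which every demand vector has positive probability. A trusted server, without access to the library, generates from $\mathbf D$ and $(\mathscr M(C_1),\mathscr M(C_2))$ (possibly at random) packet metadata $\mathscr M(P_1),\mathscr M(P_2)$ and sends $\mathscr M(P_k)$ to user $k$; all metadata have finite alphabets. User $k$ broadcasts $X_k=(\mathscr M(P_k),P_k)$, where $\mathscr M(P_k)$ describes the payload $P_k$ as a function of the library, and $\mathbf X=(X_1,X_2)$. A load $R\in\mathbb R$ is *achievable under uncoded placement with cache size $M$* if there are $\epsilon_B\ge 0$ with $\epsilon_B\to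 0$ as $B\to\infty$ and, for every $B$, such a system with uncoded placement satisfying for $k=1,2$ (entropies in bits): $H(Z_k)\le B(M+\epsilon_B)$; $H(X_k\mid \mathscr M(P_k),Z_k)=0$; $H(F_{D_k}\mid \mathbf X,Z_k,D_k)\le B\epsilon_B$; the privacy constraint $I(\mathbf D;\mathbf X,Z_k\mid D_k)=0$; and $H(X_1)+H(X_2)\le B(R+\epsilon_B)$. The minimum achievable load is denoted $R^\star_{\mathrm u}(M)$. Let $R_{\mathrm B}(M)$, $N/2\le M\le N$, be the load of Scheme B, i.e. the lower convex envelope of the memory-load pairs $(N,0)$ and $$\left(\frac N2+\frac{Nt}{2(N+t-1)},\ \frac{N(N-1)}{(t+1)(N+t-1)}\right),\qquad t=0,1,\dots,N-1 .$$ **Theorem 4.** Let $N\ge K=2$. Then, for every $M\in[N/2,N]$, the load $R_{\mathrm B}(M)$ is achievable under uncoded placement with cache size $M$. Moreover: 1. if $\frac N2\le M\le\frac{N+1}2$ or $\frac{N(3N-5)}{2(2N-3)}\le M\le N$, then Scheme B is exactly optimal under uncoded placement: $R_{\mathrm B}(M)=R^\star_{\mathrm u}(M)$, the minimum being attained; 2.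 for every $M\in[N/2,N]$, Scheme B is optimal under uncoded placement within a factor of $3$: every achievable load $R$ satisfies $R_{\mathrm B}(M)\le 3R$. -/

import Mathlib

namespace D2DPrivateCaching

noncomputable section

section Information

variable {Ω α β γ : Type*} [Fintype Ω]

open Classical in
/-- Shannon entropy `H(X)`, in bits, of a random variable `X` on a finite probability space. -/
def entropy (μ : PMF Ω) (X : Ω → α) : ℝ :=
  ∑ x ∈ Finset.univ.image X, Real.negMulLog ((μ.map X) x).toReal / Real.log 2

/-- Conditional entropy `H(X | Y)`. -/
def condEntropy (μ : PMF Ω) (X : Ω → α) (Y : Ω → β) : ℝ :=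
  entropy μ (fun ω => (X ω, Y ω)) - entropy μ Y

/-- Conditional mutual information `I(X ; Y | Z)`. -/
def condMutualInfo (μ : PMF Ω) (X : Ω → α) (Y : Ω → β) (Z : Ω → γ) : ℝ :=
  condEntropy μ X Z - condEntropy μ X (fun ω => (Y ω, Z ω))

end Information

/-- A library of `N` files of `B` bits each. -/
abbrev Library (N B : ℕ) : Type := Fin N → Fin B → Bool

/-- A demand vector of `K` users: user `k` demands the file with index `d k`. -/
abbrev Demands (K N : ℕ) : Type := Fin K → Fin N

/-- The two phases of a device-to-device caching system with a trusted server, for `K` users and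
`N` files of `B` bits (no constraint is imposed yet). -/
structure Scheme (K N B : ℕ) where
  /-- the possible cache metadata of user `k` -/
  CacheMeta : Fin K → Type
  /-- the possible metadata of the packets sent by user `k` -/
  PacketMeta : Fin K → Type
  [cacheFintype : ∀ k, Fintype (CacheMeta k)]
  [packetFintype : ∀ k, Fintype (PacketMeta k)]
  /-- the joint law of the cache metadata of the users (chosen without knowledge of the demands
  and of the file contents) -/
  placement : PMF (∀ k, CacheMeta k)
  /-- the cached content of user `k`, a function of its metadata and of the library -/
  content : ∀ k, CacheMeta k → Library N B → List Bool
  /-- the conditional law of the packet metadata that the trusted server, which has no access to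
  the library, sends to the users, given the demands and the cache metadata -/
  query : Demands K N → (∀ k, CacheMeta k) → PMF (∀ k, PacketMeta k)
  /-- the payload described by the packet metadata of user `k`: a composition of library bits -/
  payload : ∀ k, PacketMeta k → Library N B → List Bool

attribute [instance] Scheme.cacheFintype Scheme.packetFintype

namespace Scheme

variable {K N B : ℕ} (S : Scheme K N B)

/-- The outcomes: cache metadata, demands, packet metadata, files. -/
abbrev Outcome : Type :=
  (∀ k, S.CacheMeta k) × Demands K N × (∀ k, S.PacketMeta k) × Library N B

/-- The joint law of all the random variables of the system, when the demand vector has law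
`demandLaw`: the cache metadata, the demands and the files are independent, the files consist of
i.i.d. uniform bits, and the server's queries are drawn from the demands and cache metadata. -/
def law (demandLaw : PMF (Demands K N)) : PMF S.Outcome :=
  S.placement.bind fun c =>
    demandLaw.bind fun d =>
      (S.query d c).bind fun p =>
        (PMF.uniformOfFintype (Library N B)).map fun F => (c, d, p, F)

/-- The demand vector `D`. -/
def demand (ω : S.Outcome) : Demands K N := ω.2.1

/-- The packet metadata of user `k`. -/
def packetMeta (k : Fin K) (ω : S.Outcome) : S.PacketMeta k := ω.2.2.1 k

/-- The cache `Z_k` of user `k`: its metadata together with the cached content. -/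
def cache (k : Fin K) (ω : S.Outcome) : S.CacheMeta k × List Bool :=
  (ω.1 k, S.content k (ω.1 k) ω.2.2.2)

/-- The signal `X_k` broadcast by user `k`: the packet metadata together with the payload. -/
def signal (k : Fin K) (ω : S.Outcome) : S.PacketMeta k × List Bool :=
  (ω.2.2.1 k, S.payload k (ω.2.2.1 k) ω.2.2.2)

/-- The vector `X` of all the transmitted signals. -/
def signals (ω : S.Outcome) : ∀ k, S.PacketMeta k × List Bool := fun k => S.signal k ω

/-- The file demanded by user `k`. -/
def demandedFile (k : Fin K) (ω : S.Outcome) : Fin B → Bool := ω.2.2.2 (S.demand ω k)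

/-- Uncoded cache placement: every user directly copies some bits of the files into its cache. -/
def IsUncoded : Prop :=
  ∀ (k : Fin K) (c : S.CacheMeta k), ∃ positions : List (Fin N × Fin B),
    ∀ F : Library N B, S.content k c F = positions.map fun ib => F ib.1 ib.2

/-- The scheme is a working private scheme for cache size `M`, with load `R`, up to a slack `ε`. -/
structure IsValid (demandLaw : PMF (Demands K N)) (M R ε : ℝ) : Prop where
  /-- cache size constraint -/
  cache_size : ∀ k, entropy (S.law demandLaw) (S.cache k) ≤ B * (M + ε)
  /-- encoding constraint: what user `k` sends depends on its cache and its query only -/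
  encoding : ∀ k, condEntropy (S.law demandLaw) (S.signal k)
    (fun ω => (S.packetMeta k ω, S.cache k ω)) = 0
  /-- decoding constraint -/
  decoding : ∀ k, condEntropy (S.law demandLaw) (S.demandedFile k)
    (fun ω => (S.signals ω, S.cache k ω, S.demand ω k)) ≤ B * ε
  /-- privacy constraint -/
  privacy : ∀ k, condMutualInfo (S.law demandLaw) S.demand
    (fun ω => (S.signals ω, S.cache k ω)) (fun ω => S.demand ω k) = 0
  /-- load -/
  load : ∑ k, entropy (S.law demandLaw) (S.signal k) ≤ B * (R + ε)

end Scheme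

/-- The load `R` is achievable with cache size `M` under uncoded cache placement: there are private
schemes with uncoded placement for all file lengths `B`, with slacks `ε B → 0`. -/
def AchievableUncoded {K N : ℕ} (demandLaw : PMF (Demands K N)) (M R : ℝ) : Prop :=
  ∃ ε : ℕ → ℝ, (∀ B, 0 ≤ ε B) ∧ Filter.Tendsto ε Filter.atTop (nhds 0) ∧
    ∀ B : ℕ, ∃ S : Scheme K N B, S.IsUncoded ∧ S.IsValid demandLaw M R (ε B)

/-- The memory-load pairs of Scheme B for two users and `N` files, with parameter
`t = 0, …, N - 1`, together with the trivial pair `(N, 0)`. -/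
def schemeBPoints (N : ℕ) : Set (ℝ × ℝ) :=
  insert ((N : ℝ), (0 : ℝ))
    ((fun t : ℕ =>
        ((N : ℝ) / 2 + (N : ℝ) * t / (2 * ((N : ℝ) + t - 1)),
          (N : ℝ) * ((N : ℝ) - 1) / (((t : ℝ) + 1) * ((N : ℝ) + t - 1)))) '' Set.Iio N)

/-- The load of Scheme B at cache size `M` (with memory-sharing between the pairs above): the lower
convex envelope of the pairs. -/
def schemeBLoad (N : ℕ) (M : ℝ) : ℝ :=
  sInf {R : ℝ | (M, R) ∈ convexHull ℝ (schemeBPoints N)}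

end

end D2DPrivateCaching

/-
Achievability. Let one user cache the whole library and the other one a random set of pieces of
every file, whose labels are hidden by private random permutations. The first user sends, for every
set of `t + 1` files, the sum of one piece of each file. If `f` is not the demanded file, its pieces
are relabelled so that those in the sums with the demanded file are cached; the pieces of the
demanded file itself are relabelled so that its uncached pieces are among those in the sums. A
relabelling is absorbed by the random permutations, so that the labels which are sent have the same
law for all demands. Time-sharing between the two orders of the users, and between different `t`,
gives Scheme B.

Converse. By privacy, the law of what one user sees of the metadata does not depend on the demand of
the other user; changing one demand at a time shows that the law of the packet metadata does not
depend on the demands at all. Fix the packet metadata, hence the payloads: every file `f i` comes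
with caches `S i`, `T i` of the two users which produce these payloads and decode `f i` from them.
Successive decoding of `n` files bounds the entropy of each payload below by numbers of bits outside
`S 0 ∪ ⋯ ∪ S i`, respectively `T 0 ∪ ⋯ ∪ T i`. As `S j` and `T i` also produce the payloads, they
cover `f i` together, and so do `S i` and `T j`; hence the `S`'s and `T`'s overlap on `f i`, and
these unions are small. Averaging over the choice of the files yields
`R ≥ n (n + 3) / 2 - n (n + 1) M / N`. These lines are edges of Scheme B in the two extreme ranges
(`n = N` and `n = 1, 2`). In between, the lines for `k - 1` and `k` files meet at
`M = N / 2 + N / (2 k)` and height `(k - 1) / 2`, where the load of Scheme B is at most `k - 1`;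
convexity extends the factor `2` to all `M`.
-/

namespace D2DPrivateCaching

noncomputable section

section Expectation

variable {Ω γ : Type*} [Fintype Ω] (μ : PMF Ω) {g h : Ω → ℝ}

/-- The expectation of a real random variable on a finite probability space. -/
def expect (μ : PMF Ω) (g : Ω → ℝ) : ℝ := ∑ ω, (μ ω).toReal * g ω

theorem sum_toReal_eq_one : ∑ ω, (μ ω).toReal = 1 := by
  have h := μ.tsum_coe
  rw [tsum_fintype] at h
  rw [← ENNReal.toReal_sum fun ω _ => μ.apply_ne_top ω, h, ENNReal.toReal_one]

theorem expect_const (c : ℝ) : expect μ (fun _ => c) = c := by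
  rw [expect, ← Finset.sum_mul, sum_toReal_eq_one, one_mul]

theorem expect_add (g h : Ω → ℝ) :
    expect μ (fun ω => g ω + h ω) = expect μ g + expect μ h := by
  simp only [expect, mul_add, Finset.sum_add_distrib]

theorem expect_sub (g h : Ω → ℝ) :
    expect μ (fun ω => g ω - h ω) = expect μ g - expect μ h := by
  simp only [expect, mul_sub, Finset.sum_sub_distrib]

theorem expect_const_mul (c : ℝ) (g : Ω → ℝ) : expect μ (fun ω => c * g ω) = c * expect μ g := by
  simp only [expect, Finset.mul_sum, mul_left_comm]

theorem expect_div_const (g : Ω → ℝ) (c : ℝ) : expect μ (fun ω => g ω / c) = expect μ g / c := by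
  simp only [expect, mul_div_assoc', Finset.sum_div]

theorem expect_sum {ι : Type*} (s : Finset ι) (g : ι → Ω → ℝ) :
    expect μ (fun ω => ∑ i ∈ s, g i ω) = ∑ i ∈ s, expect μ (g i) := by
  simp only [expect, Finset.mul_sum]
  exact Finset.sum_comm

variable {μ}

theorem expect_mono (hgh : ∀ ω ∈ μ.support, g ω ≤ h ω) : expect μ g ≤ expect μ h := by
  refine Finset.sum_le_sum fun ω _ => ?_
  by_cases hω : ω ∈ μ.support
  · exact mul_le_mul_of_nonneg_left (hgh ω hω) ENNReal.toReal_nonneg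
  · simp [(μ.apply_eq_zero_iff ω).2 hω]

theorem expect_congr (hgh : ∀ ω ∈ μ.support, g ω = h ω) : expect μ g = expect μ h :=
  (expect_mono fun ω hω => (hgh ω hω).le).antisymm (expect_mono fun ω hω => (hgh ω hω).ge)

theorem expect_bind [Fintype γ] (ν : PMF γ) (κ : γ → PMF Ω) (g : Ω → ℝ) :
    expect (ν.bind κ) g = expect ν fun c => expect (κ c) g := by
  simp only [expect, PMF.bind_apply, tsum_fintype, Finset.mul_sum]
  rw [Finset.sum_comm]
  refine Finset.sum_congr rfl fun ω _ => ?_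
  rw [ENNReal.toReal_sum fun c _ => ENNReal.mul_ne_top (ν.apply_ne_top c) ((κ c).apply_ne_top ω),
    Finset.sum_mul]
  simp only [ENNReal.toReal_mul, mul_assoc]

theorem expect_map [Fintype γ] (ν : PMF γ) (f : γ → Ω) (g : Ω → ℝ) :
    expect (ν.map f) g = expect ν (g ∘ f) := by
  classical
  rw [PMF.map, expect_bind]
  refine congrArg (expect ν) (funext fun c => ?_)
  simp [expect, PMF.pure_apply, apply_ite ENNReal.toReal]

end Expectation

section Probability

variable {Ω α β γ : Type*}

/-- The probability, as a real number, that the random variable `X` takes the value `a`. -/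
def prob (μ : PMF Ω) (X : Ω → α) (a : α) : ℝ := ((μ.map X) a).toReal

variable {μ : PMF Ω} {X : Ω → α}

theorem prob_nonneg (a : α) : 0 ≤ prob μ X a := ENNReal.toReal_nonneg

theorem prob_pos {ω : Ω} (hω : ω ∈ μ.support) : 0 < prob μ X (X ω) :=
  ENNReal.toReal_pos ((PMF.mem_support_map_iff _ _ _).2 ⟨ω, hω, rfl⟩) (PMF.apply_ne_top _ _)

theorem prob_eq_zero {a : α} (h : ∀ ω ∈ μ.support, X ω ≠ a) : prob μ X a = 0 := by
  rw [prob, ((μ.map X).apply_eq_zero_iff a).2, ENNReal.toReal_zero]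
  rw [PMF.mem_support_map_iff]
  rintro ⟨ω, hω, rfl⟩
  exact h ω hω rfl

theorem prob_mono {Y : Ω → β} {a : α} {b : β} (h : ∀ ω ∈ μ.support, X ω = a → Y ω = b) :
    prob μ X a ≤ prob μ Y b := by
  refine ENNReal.toReal_mono (PMF.apply_ne_top _ _) ?_
  rw [← PMF.toOuterMeasure_apply_singleton, ← PMF.toOuterMeasure_apply_singleton,
    PMF.toOuterMeasure_map_apply, PMF.toOuterMeasure_map_apply]
  exact PMF.toOuterMeasure_mono _ fun ω hω => h ω hω.2 hω.1

theorem prob_congr {Y : Ω → β} {a : α} {b : β} (h : ∀ ω ∈ μ.support, X ω = a ↔ Y ω = b) :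
    prob μ X a = prob μ Y b :=
  (prob_mono fun ω hω => (h ω hω).1).antisymm (prob_mono fun ω hω => (h ω hω).2)

theorem prob_eq_apply {a : α} {ω₀ : Ω} (h : ∀ ω ∈ μ.support, X ω = a ↔ ω = ω₀) :
    prob μ X a = (μ ω₀).toReal := by
  rw [prob_congr (Y := id) h, prob, PMF.map_id]

theorem prob_const [DecidableEq α] (μ : PMF Ω) (a b : α) :
    prob μ (fun _ => a) b = if b = a then 1 else 0 := by
  rw [prob, show (fun _ : Ω => a) = Function.const Ω a from rfl, PMF.map_const, PMF.pure_apply]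
  split_ifs <;> simp

theorem prob_map (f : γ → Ω) (ν : PMF γ) (X : Ω → α) (a : α) :
    prob (ν.map f) X a = prob ν (X ∘ f) a := by
  rw [prob, PMF.map_comp, prob]

theorem prob_bind [Fintype γ] (ν : PMF γ) (κ : γ → PMF Ω) (X : Ω → α) (a : α) :
    prob (ν.bind κ) X a = expect ν fun c => prob (κ c) X a := by
  rw [prob, PMF.map_bind, PMF.bind_apply, tsum_fintype,
    ENNReal.toReal_sum fun c _ => ENNReal.mul_ne_top (ν.apply_ne_top c) (PMF.apply_ne_top _ a)]
  simp only [ENNReal.toReal_mul, expect, prob]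

variable [Fintype Ω]

theorem prob_eq_expect (μ : PMF Ω) (X : Ω → α) (a : α) :
    prob μ X a = expect μ ((X ⁻¹' {a}).indicator 1) := by
  classical
  rw [prob, PMF.map_apply, tsum_fintype, ENNReal.toReal_sum fun ω _ => by
    split_ifs
    exacts [μ.apply_ne_top ω, ENNReal.zero_ne_top], expect]
  refine Finset.sum_congr rfl fun ω _ => ?_
  by_cases h : a = X ω <;> simp [h, Set.indicator, eq_comm]

theorem sum_prob_mul {s : Finset α} (hs : ∀ ω, X ω ∈ s) (g : α → ℝ) :
    ∑ a ∈ s, prob μ X a * g a = expect μ (g ∘ X) := by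
  classical
  simp only [prob_eq_expect, expect, Finset.sum_mul]
  rw [Finset.sum_comm]
  refine Finset.sum_congr rfl fun ω _ => ?_
  rw [Finset.sum_eq_single_of_mem (X ω) (hs ω)]
  · simp
  · intro a _ ha
    simp [ha.symm]

theorem sum_prob_eq_one {s : Finset α} (hs : ∀ ω, X ω ∈ s) : ∑ a ∈ s, prob μ X a = 1 := by
  simpa [Function.comp_def, expect_const] using sum_prob_mul (μ := μ) hs 1

theorem sum_prob_pair {s : Finset α} (hs : ∀ ω, X ω ∈ s) (Z : Ω → γ) (c : γ) :
    ∑ a ∈ s, prob μ (fun ω => (X ω, Z ω)) (a, c) = prob μ Z c := by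
  classical
  simp only [prob_eq_expect, ← expect_sum]
  refine congrArg (expect μ) (funext fun ω => ?_)
  rw [Finset.sum_eq_single_of_mem (X ω) (hs ω)]
  · simp [Set.indicator]
  · intro a _ ha
    simp [ha.symm]

end Probability

section CondIndep

variable {Ω α β γ : Type*} {μ : PMF Ω} {X : Ω → α} {Y : Ω → β} {Z : Ω → γ}

/-- The probability of the triple under the law with the same marginals `(X, Z)` and `(Y, Z)` that
makes `X` and `Y` conditionally independent given `Z`. -/
def condIndepProb (μ : PMF Ω) (X : Ω → α) (Y : Ω → β) (Z : Ω → γ) (t : α × β × γ) : ℝ :=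
  prob μ (fun ω => (X ω, Z ω)) (t.1, t.2.2) * prob μ (fun ω => (Y ω, Z ω)) t.2 / prob μ Z t.2.2

theorem condIndepProb_nonneg (t : α × β × γ) : 0 ≤ condIndepProb μ X Y Z t :=
  div_nonneg (mul_nonneg (prob_nonneg _) (prob_nonneg _)) (prob_nonneg _)

theorem prob_eq_zero_of_condIndepProb_eq_zero {t : α × β × γ}
    (h : condIndepProb μ X Y Z t = 0) : prob μ (fun ω => (X ω, Y ω, Z ω)) t = 0 := by
  refine prob_eq_zero fun ω hω hωt => ?_
  subst hωt
  have hXZ := prob_pos (X := fun ω => (X ω, Z ω)) hω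
  have hYZ := prob_pos (X := fun ω => (Y ω, Z ω)) hω
  exact (div_pos (mul_pos hXZ hYZ) (prob_pos hω)).ne' h

theorem condIndepProb_mul_klFun_nonneg (x : α × β × γ) :
    0 ≤ condIndepProb μ X Y Z x * InformationTheory.klFun
      (prob μ (fun ω => (X ω, Y ω, Z ω)) x / condIndepProb μ X Y Z x) :=
  mul_nonneg (condIndepProb_nonneg x) (InformationTheory.klFun_nonneg
    (div_nonneg (prob_nonneg _) (condIndepProb_nonneg x)))

theorem prob_mul_prob_eq_iff {a : α} {b : β} {c : γ} :
    prob μ (fun ω => (X ω, Y ω, Z ω)) (a, b, c) * prob μ Z c =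
      prob μ (fun ω => (X ω, Z ω)) (a, c) * prob μ (fun ω => (Y ω, Z ω)) (b, c) ↔
      prob μ (fun ω => (X ω, Y ω, Z ω)) (a, b, c) = condIndepProb μ X Y Z (a, b, c) := by
  rcases eq_or_ne (prob μ Z c) 0 with hc | hc
  · have hXYZ : prob μ (fun ω => (X ω, Y ω, Z ω)) (a, b, c) = 0 :=
      (prob_mono fun ω _ h => (Prod.ext_iff.1 (Prod.ext_iff.1 h).2).2).trans_eq hc |>.antisymm
        (prob_nonneg _)
    have hXZ : prob μ (fun ω => (X ω, Z ω)) (a, c) = 0 :=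
      (prob_mono fun ω _ h => (Prod.ext_iff.1 h).2).trans_eq hc |>.antisymm (prob_nonneg _)
    simp [condIndepProb, hc, hXYZ, hXZ]
  · rw [condIndepProb, eq_div_iff hc]

end CondIndep

section Entropy

variable {Ω α β γ : Type*} [Fintype Ω] {μ : PMF Ω} {X : Ω → α} {Y : Ω → β} {Z : Ω → γ}

theorem entropy_eq_expect (μ : PMF Ω) (X : Ω → α) :
    entropy μ X = expect μ fun ω => -Real.logb 2 (prob μ X (X ω)) := by
  classical
  refine Eq.trans ?_ (sum_prob_mul (s := Finset.univ.image X) (by simp)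
    fun a => -Real.logb 2 (prob μ X a))
  rw [entropy]
  refine Finset.sum_congr (by congr) fun a _ => ?_
  rw [Real.negMulLog, Real.logb, prob]
  ring

theorem entropy_mono (h : ∀ ω ∈ μ.support, ∀ ω' ∈ μ.support, X ω = X ω' → Y ω = Y ω') :
    entropy μ Y ≤ entropy μ X := by
  rw [entropy_eq_expect, entropy_eq_expect]
  refine expect_mono fun ω hω => neg_le_neg ?_
  exact Real.logb_le_logb_of_le one_lt_two (prob_pos hω)
    (prob_mono fun ω' hω' hX => h ω' hω' ω hω hX)

theorem entropy_congr (h : ∀ ω ∈ μ.support, ∀ ω' ∈ μ.support, X ω = X ω' ↔ Y ω = Y ω') :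
    entropy μ X = entropy μ Y :=
  (entropy_mono fun ω hω ω' hω' => (h ω hω ω' hω').2).antisymm
    (entropy_mono fun ω hω ω' hω' => (h ω hω ω' hω').1)

theorem entropy_map {Ω' : Type*} [Fintype Ω'] (ν : PMF Ω') (f : Ω' → Ω) (X : Ω → α) :
    entropy (ν.map f) X = entropy ν (X ∘ f) := by
  rw [entropy_eq_expect, entropy_eq_expect, expect_map]
  simp only [prob_map, Function.comp_def]

theorem entropy_le_logb_card [Fintype α] (μ : PMF Ω) (X : Ω → α) :
    entropy μ X ≤ Real.logb 2 (Fintype.card α) := by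
  obtain ⟨ω₀, -⟩ := μ.support_nonempty
  have : Nonempty α := ⟨X ω₀⟩
  set n : ℝ := (Fintype.card α : ℝ)
  have hn : 0 < n := Nat.cast_pos.2 Fintype.card_pos
  have hlog : ∀ ω ∈ μ.support, -Real.logb 2 (prob μ X (X ω)) - Real.logb 2 n ≤
      ((n * prob μ X (X ω))⁻¹ - 1) / Real.log 2 := fun ω hω => by
    have hp := prob_pos (X := X) hω
    rw [Real.logb, Real.logb, ← neg_div, ← sub_div,
      ← neg_add', add_comm, ← Real.log_mul hn.ne' hp.ne', ← Real.log_inv]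
    gcongr
    exact Real.log_le_sub_one_of_pos (by positivity)
  have hinv : expect μ (fun ω => (n * prob μ X (X ω))⁻¹) ≤ 1 := by
    rw [← Function.comp_def (fun a => (n * prob μ X a)⁻¹) X,
      ← sum_prob_mul (s := Finset.univ) fun _ => Finset.mem_univ _]
    calc ∑ a, prob μ X a * (n * prob μ X a)⁻¹ ≤ ∑ _a : α, n⁻¹ := by
          refine Finset.sum_le_sum fun a _ => ?_
          rw [mul_inv, mul_left_comm]
          exact mul_le_of_le_one_right (by positivity) mul_inv_le_one
      _ = 1 := by simp [n]
  have hle := expect_mono hlog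
  rw [expect_sub, expect_const, ← entropy_eq_expect, expect_div_const, expect_sub,
    expect_const] at hle
  have hneg : (expect μ (fun ω => (n * prob μ X (X ω))⁻¹) - 1) / Real.log 2 ≤ 0 :=
    div_nonpos_of_nonpos_of_nonneg (by linarith) (Real.log_nonneg one_le_two)
  linarith

theorem condEntropy_nonneg (μ : PMF Ω) (X : Ω → α) (Y : Ω → β) : 0 ≤ condEntropy μ X Y :=
  sub_nonneg.2 (entropy_mono fun _ _ _ _ h => (Prod.ext_iff.1 h).2)

theorem sum_condIndepProb {s : Finset α} {t : Finset β} {u : Finset γ} (hs : ∀ ω, X ω ∈ s)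
    (ht : ∀ ω, Y ω ∈ t) (hu : ∀ ω, Z ω ∈ u) :
    ∑ x ∈ s ×ˢ t ×ˢ u, condIndepProb μ X Y Z x = 1 := by
  calc ∑ x ∈ s ×ˢ t ×ˢ u, condIndepProb μ X Y Z x
      = ∑ c ∈ u, (∑ a ∈ s, prob μ (fun ω => (X ω, Z ω)) (a, c)) *
          (∑ b ∈ t, prob μ (fun ω => (Y ω, Z ω)) (b, c)) / prob μ Z c := by
        simp only [Finset.sum_product, Finset.sum_mul_sum, condIndepProb, Finset.sum_div]
        rw [Finset.sum_congr rfl fun a _ => Finset.sum_comm, Finset.sum_comm]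
    _ = ∑ c ∈ u, prob μ Z c := Finset.sum_congr rfl fun c _ => by
        rw [sum_prob_pair hs, sum_prob_pair ht, mul_self_div_self]
    _ = 1 := sum_prob_eq_one hu

theorem condMutualInfo_eq_expect (μ : PMF Ω) (X : Ω → α) (Y : Ω → β) (Z : Ω → γ) :
    condMutualInfo μ X Y Z = expect μ fun ω =>
      Real.logb 2 (prob μ (fun ω => (X ω, Y ω, Z ω)) (X ω, Y ω, Z ω) /
        condIndepProb μ X Y Z (X ω, Y ω, Z ω)) := by
  simp only [condMutualInfo, condEntropy, entropy_eq_expect, ← expect_sub]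
  refine expect_congr fun ω hω => ?_
  have hXZ := prob_pos (X := fun ω => (X ω, Z ω)) hω
  have hYZ := prob_pos (X := fun ω => (Y ω, Z ω)) hω
  have hZ := prob_pos (X := Z) hω
  have hXYZ := prob_pos (X := fun ω => (X ω, Y ω, Z ω)) hω
  rw [condIndepProb, Real.logb_div hXYZ.ne' (by positivity), Real.logb_div (by positivity) hZ.ne',
    Real.logb_mul hXZ.ne' hYZ.ne']
  ring

theorem condMutualInfo_eq_sum_klFun {s : Finset α} {t : Finset β} {u : Finset γ}
    (hs : ∀ ω, X ω ∈ s) (ht : ∀ ω, Y ω ∈ t) (hu : ∀ ω, Z ω ∈ u) :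
    condMutualInfo μ X Y Z = (∑ x ∈ s ×ˢ t ×ˢ u, condIndepProb μ X Y Z x *
      InformationTheory.klFun (prob μ (fun ω => (X ω, Y ω, Z ω)) x /
        condIndepProb μ X Y Z x)) / Real.log 2 := by
  have hstu : ∀ ω, (X ω, Y ω, Z ω) ∈ s ×ˢ t ×ˢ u := fun ω => by simp [hs, ht, hu]
  set p := prob μ fun ω => (X ω, Y ω, Z ω)
  set q := condIndepProb μ X Y Z
  have hkl : ∀ x, q x * InformationTheory.klFun (p x / q x) =
      p x * Real.log (p x / q x) + q x - p x := fun x => by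
    rcases eq_or_ne (q x) 0 with hq | hq
    · simp [hq, show p x = 0 from prob_eq_zero_of_condIndepProb_eq_zero hq]
    · rw [InformationTheory.klFun_apply]
      field_simp
  rw [condMutualInfo_eq_expect]
  simp only [Real.logb]
  rw [expect_div_const]
  change expect μ ((fun x => Real.log (p x / q x)) ∘ fun ω => (X ω, Y ω, Z ω)) / _ = _
  rw [← sum_prob_mul hstu]
  simp only [hkl, Finset.sum_add_distrib, Finset.sum_sub_distrib]
  rw [sum_condIndepProb hs ht hu, sum_prob_eq_one hstu, add_sub_cancel_right]

theorem condMutualInfo_nonneg (μ : PMF Ω) (X : Ω → α) (Y : Ω → β) (Z : Ω → γ) :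
    0 ≤ condMutualInfo μ X Y Z := by
  classical
  rw [condMutualInfo_eq_sum_klFun (s := Finset.univ.image X) (t := Finset.univ.image Y)
    (u := Finset.univ.image Z) (by simp) (by simp) (by simp)]
  exact div_nonneg (Finset.sum_nonneg fun x _ => condIndepProb_mul_klFun_nonneg x)
    (Real.log_nonneg one_le_two)

theorem condMutualInfo_eq_zero_iff_forall_mem {s : Finset α} {t : Finset β} {u : Finset γ}
    (hs : ∀ ω, X ω ∈ s) (ht : ∀ ω, Y ω ∈ t) (hu : ∀ ω, Z ω ∈ u) :
    condMutualInfo μ X Y Z = 0 ↔ ∀ x ∈ s ×ˢ t ×ˢ u,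
      prob μ (fun ω => (X ω, Y ω, Z ω)) x = condIndepProb μ X Y Z x := by
  rw [condMutualInfo_eq_sum_klFun hs ht hu, div_eq_zero_iff,
    or_iff_left (Real.log_pos one_lt_two).ne',
    Finset.sum_eq_zero_iff_of_nonneg fun x _ => condIndepProb_mul_klFun_nonneg x]
  refine forall₂_congr fun x _ => ?_
  rw [mul_eq_zero, InformationTheory.klFun_eq_zero_iff
    (div_nonneg (prob_nonneg _) (condIndepProb_nonneg x))]
  rcases eq_or_ne (condIndepProb μ X Y Z x) 0 with hq | hq
  · simp [hq, prob_eq_zero_of_condIndepProb_eq_zero hq]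
  · simp [hq, div_eq_one_iff_eq]

theorem condMutualInfo_eq_zero_iff : condMutualInfo μ X Y Z = 0 ↔
    ∀ a b c, prob μ (fun ω => (X ω, Y ω, Z ω)) (a, b, c) * prob μ Z c =
      prob μ (fun ω => (X ω, Z ω)) (a, c) * prob μ (fun ω => (Y ω, Z ω)) (b, c) := by
  classical
  constructor
  · intro h a b c
    refine prob_mul_prob_eq_iff.2 ((condMutualInfo_eq_zero_iff_forall_mem
      (s := insert a (Finset.univ.image X)) (t := insert b (Finset.univ.image Y))
      (u := insert c (Finset.univ.image Z)) ?_ ?_ ?_).1 h _ ?_) <;> simp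
  · intro h
    exact (condMutualInfo_eq_zero_iff_forall_mem (s := Finset.univ.image X)
      (t := Finset.univ.image Y) (u := Finset.univ.image Z) (by simp) (by simp) (by simp)).2
      fun x _ => prob_mul_prob_eq_iff.1 (h _ _ _)

theorem condEntropy_eq_zero_iff : condEntropy μ X Y = 0 ↔
    ∀ ω ∈ μ.support, ∀ ω' ∈ μ.support, Y ω = Y ω' → X ω = X ω' := by
  constructor
  · -- `H(X | Y) = 0` makes `X` conditionally independent of itself given `Y`.
    intro h ω hω ω' hω' hY
    by_contra hX
    have hself : condEntropy μ X (fun ω => (X ω, Y ω)) = 0 :=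
      sub_eq_zero.2 (entropy_congr fun _ _ _ _ => by simp)
    have hindep := condMutualInfo_eq_zero_iff.1
      (show condMutualInfo μ X X Y = 0 by rw [condMutualInfo, h, hself, sub_zero])
      (X ω) (X ω') (Y ω)
    rw [prob_eq_zero (a := (X ω, X ω', Y ω)), zero_mul] at hindep
    · refine (mul_pos ?_ ?_).ne hindep
      · exact prob_pos (X := fun ω => (X ω, Y ω)) hω
      · rw [hY]
        exact prob_pos (X := fun ω => (X ω, Y ω)) hω'
    · intro ω'' _ h
      simp only [Prod.mk.injEq] at h
      exact hX (h.1.symm.trans h.2.1)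
  · intro h
    refine sub_eq_zero.2 (entropy_congr fun ω hω ω' hω' => ?_)
    simpa using h ω hω ω' hω'

theorem condEntropy_pair_le (μ : PMF Ω) (X : Ω → α) (Y : Ω → β) (Z : Ω → γ) :
    condEntropy μ X (fun ω => (Y ω, Z ω)) ≤ condEntropy μ X Z :=
  sub_nonneg.1 (condMutualInfo_nonneg μ X Y Z)

theorem condEntropy_congr_right
    (h : ∀ ω ∈ μ.support, ∀ ω' ∈ μ.support, Y ω = Y ω' ↔ Z ω = Z ω') :
    condEntropy μ X Y = condEntropy μ X Z := by
  rw [condEntropy, condEntropy, entropy_congr h,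
    entropy_congr (X := fun ω => (X ω, Y ω)) (Y := fun ω => (X ω, Z ω)) fun ω hω ω' hω' => by
      simp only [Prod.mk.injEq, h ω hω ω' hω']]

theorem condEntropy_le_condEntropy
    (h : ∀ ω ∈ μ.support, ∀ ω' ∈ μ.support, Y ω = Y ω' → Z ω = Z ω') :
    condEntropy μ X Y ≤ condEntropy μ X Z := by
  rw [condEntropy_congr_right (Z := fun ω => (Y ω, Z ω)) fun ω hω ω' hω' => by
    simpa using h ω hω ω' hω']
  exact condEntropy_pair_le μ X Y Z

theorem condEntropy_const (μ : PMF Ω) (X : Ω → α) (c : γ) :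
    condEntropy μ X (fun _ => c) = entropy μ X := by
  have hc : entropy μ (fun _ => c) = 0 := by
    rw [entropy_eq_expect, expect_congr (h := fun _ => 0), expect_const]
    intro _ _
    classical
    rw [prob_const, if_pos rfl, Real.logb_one, neg_zero]
  rw [condEntropy, hc, sub_zero, entropy_congr (Y := X) fun _ _ _ _ => by simp]

theorem condEntropy_le_entropy (μ : PMF Ω) (X : Ω → α) (Y : Ω → β) :
    condEntropy μ X Y ≤ entropy μ X :=
  (condEntropy_le_condEntropy (Z := fun _ => ()) fun _ _ _ _ _ => rfl).trans_eq
    (condEntropy_const μ X ())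

theorem entropy_pair_le (μ : PMF Ω) (X : Ω → α) (Y : Ω → β) :
    entropy μ (fun ω => (X ω, Y ω)) ≤ entropy μ X + entropy μ Y :=
  sub_le_iff_le_add.1 (condEntropy_le_entropy μ X Y)

end Entropy

section Mixture

variable {Ω α β γ : Type*} [Fintype γ] {ν : PMF γ} {κ : γ → PMF Ω} {M : Ω → γ}

theorem prob_pair_bind (hM : ∀ c, ∀ ω ∈ (κ c).support, M ω = c) (X : Ω → α) (a : α) (c : γ) :
    prob (ν.bind κ) (fun ω => (X ω, M ω)) (a, c) = (ν c).toReal * prob (κ c) X a := by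
  rw [prob_bind, expect, Finset.sum_eq_single c]
  · rw [prob_congr (Y := X) (b := a) fun ω hω => by simp [hM c ω hω]]
  · intro c' _ hc
    rw [prob_eq_zero fun ω hω => by simp [hM c' ω hω, hc], mul_zero]
  · simp

variable [Fintype Ω]

theorem entropy_pair_bind (hM : ∀ c, ∀ ω ∈ (κ c).support, M ω = c) (X : Ω → α) :
    entropy (ν.bind κ) (fun ω => (X ω, M ω)) =
      entropy ν id + expect ν fun c => entropy (κ c) X := by
  simp only [entropy_eq_expect, expect_bind, ← expect_add]
  refine expect_congr fun c hc => ?_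
  have hνc : prob ν id (id c) = (ν c).toReal := by rw [prob, PMF.map_id, id]
  rw [← expect_const (κ c) (-Real.logb 2 (prob ν id (id c))), ← expect_add]
  refine expect_congr fun ω hω => ?_
  have hpos : 0 < prob ν id (id c) := prob_pos hc
  rw [hM c ω hω, prob_pair_bind hM, ← hνc,
    Real.logb_mul hpos.ne' (prob_pos hω).ne', neg_add]

theorem condEntropy_bind (hM : ∀ c, ∀ ω ∈ (κ c).support, M ω = c) (X : Ω → α) (Y : Ω → β) :
    condEntropy (ν.bind κ) X (fun ω => (Y ω, M ω)) =
      expect ν fun c => condEntropy (κ c) X Y := by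
  rw [condEntropy, entropy_congr (Y := fun ω => ((X ω, Y ω), M ω)) fun _ _ _ _ => by
    simp [and_assoc], entropy_pair_bind hM, entropy_pair_bind hM, add_sub_add_left_eq_sub,
    ← expect_sub]
  rfl

theorem expect_condEntropy_le (hM : ∀ c, ∀ ω ∈ (κ c).support, M ω = c) (X : Ω → α) (Y : Ω → β) :
    expect ν (fun c => condEntropy (κ c) X Y) ≤ condEntropy (ν.bind κ) X Y := by
  rw [← condEntropy_bind hM]
  exact condEntropy_le_condEntropy fun _ _ _ _ h => (Prod.ext_iff.1 h).1

end Mixture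

section Privacy

variable {Ω α β γ δ η : Type*} {μ : PMF Ω}

theorem condMutualInfo_comp_le [Fintype Ω] (μ : PMF Ω) (X : Ω → α) (Y : Ω → β) (Z : Ω → γ)
    (g : β → δ) : condMutualInfo μ X (g ∘ Y) Z ≤ condMutualInfo μ X Y Z := by
  refine sub_le_sub_left (condEntropy_le_condEntropy fun ω _ ω' _ h => ?_) _
  rw [Prod.mk.injEq] at h
  exact Prod.ext (congrArg g h.1) h.2

variable [Fintype δ] {ν : PMF δ} {V : δ → PMF β} {D : Ω → δ} {Y : Ω → β}

theorem prob_comp_of_map_eq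
    (hμ : μ.map (fun ω => (D ω, Y ω)) = ν.bind fun d => (V d).map (Prod.mk d))
    (g : δ → β → η) (e : η) :
    prob μ (fun ω => g (D ω) (Y ω)) e = expect ν fun d => prob (V d) (g d) e := by
  change prob μ (Function.uncurry g ∘ fun ω => (D ω, Y ω)) e = _
  rw [← prob_map, hμ, prob_bind]
  simp only [prob_map]
  rfl

theorem expect_eq_single {d : δ} {g : δ → ℝ} (hg : ∀ d' ≠ d, g d' = 0) :
    expect ν g = (ν d).toReal * g d :=
  Finset.sum_eq_single_of_mem d (Finset.mem_univ d) fun d' _ h => by rw [hg d' h, mul_zero]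

theorem prob_comp_fst_of_map_eq
    (hμ : μ.map (fun ω => (D ω, Y ω)) = ν.bind fun d => (V d).map (Prod.mk d)) (f : δ → γ)
    (c : γ) : prob μ (fun ω => f (D ω)) c = prob ν f c := by
  classical
  rw [prob_comp_of_map_eq hμ fun d _ => f d, prob_eq_expect ν f]
  refine congrArg (expect ν) (funext fun d => ?_)
  simp [prob_const, Set.indicator, eq_comm]

theorem prob_fst_comp_fst_of_map_eq [DecidableEq γ]
    (hμ : μ.map (fun ω => (D ω, Y ω)) = ν.bind fun d => (V d).map (Prod.mk d)) (f : δ → γ)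
    (a : δ) (c : γ) : prob μ (fun ω => (D ω, f (D ω))) (a, c) =
      (ν a).toReal * if c = f a then 1 else 0 := by
  classical
  rw [prob_comp_of_map_eq hμ fun d _ => (d, f d), expect_eq_single (d := a)]
  · simp [prob_const]
  · exact fun d hd => prob_eq_zero fun y _ => by simp [hd]

theorem prob_fst_snd_comp_fst_of_map_eq [DecidableEq γ]
    (hμ : μ.map (fun ω => (D ω, Y ω)) = ν.bind fun d => (V d).map (Prod.mk d)) (f : δ → γ)
    (a : δ) (b : β) (c : γ) : prob μ (fun ω => (D ω, Y ω, f (D ω))) (a, b, c) =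
      (ν a).toReal * if c = f a then (V a b).toReal else 0 := by
  rw [prob_comp_of_map_eq hμ fun d y => (d, y, f d), expect_eq_single (d := a)]
  · split_ifs with h
    · rw [prob_eq_apply (ω₀ := b) fun y _ => by simp [h]]
    · rw [prob_eq_zero fun y _ => by simp [Ne.symm h]]
  · exact fun d hd => prob_eq_zero fun y _ => by simp [hd]

theorem prob_snd_comp_fst_of_map_eq [DecidableEq γ]
    (hμ : μ.map (fun ω => (D ω, Y ω)) = ν.bind fun d => (V d).map (Prod.mk d)) (f : δ → γ)
    (b : β) (c : γ) : prob μ (fun ω => (Y ω, f (D ω))) (b, c) =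
      expect ν fun d => if c = f d then (V d b).toReal else 0 := by
  rw [prob_comp_of_map_eq hμ fun d y => (y, f d)]
  refine congrArg (expect ν) (funext fun d => ?_)
  split_ifs with h
  · exact prob_eq_apply fun y _ => by simp [h]
  · exact prob_eq_zero fun y _ => by simp [Ne.symm h]

theorem condMutualInfo_eq_zero_iff_of_map_eq [Fintype Ω]
    (hμ : μ.map (fun ω => (D ω, Y ω)) = ν.bind fun d => (V d).map (Prod.mk d)) (f : δ → γ) :
    condMutualInfo μ D Y (fun ω => f (D ω)) = 0 ↔
      ∀ d ∈ ν.support, ∀ d' ∈ ν.support, f d = f d' → V d = V d' := by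
  classical
  rw [condMutualInfo_eq_zero_iff]
  simp only [prob_comp_fst_of_map_eq hμ, prob_fst_comp_fst_of_map_eq hμ,
    prob_fst_snd_comp_fst_of_map_eq hμ, prob_snd_comp_fst_of_map_eq hμ]
  set r : β → γ → ℝ := fun b c => expect ν fun d => if c = f d then (V d b).toReal else 0
  constructor
  · intro h d hd d' hd' hdd'
    have hV : ∀ a ∈ ν.support, ∀ b, (V a b).toReal = r b (f a) / prob ν f (f a) := fun a ha b => by
      have hνa : (ν a).toReal ≠ 0 := ENNReal.toReal_ne_zero.2 ⟨ha, ν.apply_ne_top a⟩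
      have hab := h a b (f a)
      rw [if_pos rfl, if_pos rfl, mul_one, mul_assoc] at hab
      exact eq_div_of_mul_eq (prob_pos ha).ne' (mul_left_cancel₀ hνa hab)
    ext b
    rw [← ENNReal.toReal_eq_toReal_iff' (PMF.apply_ne_top _ _) (PMF.apply_ne_top _ _), hV d hd,
      hV d' hd', hdd']
  · intro h a b c
    by_cases ha : a ∈ ν.support ∧ c = f a
    · obtain ⟨ha, rfl⟩ := ha
      have hr : r b (f a) = (V a b).toReal * prob ν f (f a) := by
        rw [prob_eq_expect, ← expect_const_mul]
        refine expect_congr fun d hd => ?_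
        by_cases hda : f a = f d
        · simp [hda, h a ha d hd hda]
        · simp [hda, Ne.symm hda]
      change _ = _ * r b (f a)
      rw [hr, if_pos rfl, if_pos rfl]
      ring
    · rcases not_and_or.1 ha with ha | ha
      · simp [(ν.apply_eq_zero_iff a).2 ha]
      · simp [ha]

end Privacy

section Counting

variable {ι : Type*} [DecidableEq ι]

theorem card_sub_le_card_sdiff_biUnion (P : Finset ι) (S : ℕ → Finset ι) (i : ℕ) :
    (P.card : ℝ) - (P ∩ S i).card - ∑ j ∈ Finset.range i,
      (((P ∩ S j).card : ℝ) - (P ∩ (S j ∩ S i)).card) ≤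
      (P \ (Finset.range (i + 1)).biUnion S).card := by
  have hcover : P ⊆ (P \ (Finset.range (i + 1)).biUnion S) ∪
      ((P ∩ S i) ∪ (Finset.range i).biUnion fun j => (P ∩ S j) \ (P ∩ (S j ∩ S i))) := by
    intro x hx
    simp only [Finset.range_add_one, Finset.biUnion_insert, Finset.mem_union, Finset.mem_sdiff,
      Finset.mem_biUnion, Finset.mem_inter, hx, true_and, not_or, not_exists, not_and]
    by_cases hi : x ∈ S i
    · exact .inr (.inl hi)
    · by_cases h : ∃ j ∈ Finset.range i, x ∈ S j
      · obtain ⟨j, hj, hxj⟩ := h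
        exact .inr (.inr ⟨j, hj, hxj, fun _ => hi⟩)
      · exact .inl ⟨hi, fun j hj hxj => h ⟨j, hj, hxj⟩⟩
  have hcard := (Finset.card_le_card hcover).trans ((Finset.card_union_le _ _).trans
    (Nat.add_le_add_left ((Finset.card_union_le _ _).trans
      (Nat.add_le_add_left Finset.card_biUnion_le _)) _))
  have hsdiff : ∀ j, (((P ∩ S j) \ (P ∩ (S j ∩ S i))).card : ℝ) =
      (P ∩ S j).card - (P ∩ (S j ∩ S i)).card := fun j =>
    Finset.cast_card_sdiff (Finset.inter_subset_inter_left Finset.inter_subset_left)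
  simp only [← hsdiff]
  have hcard' : (P.card : ℝ) ≤ (P \ (Finset.range (i + 1)).biUnion S).card +
      ((P ∩ S i).card + ∑ j ∈ Finset.range i, (((P ∩ S j) \ (P ∩ (S j ∩ S i))).card : ℝ)) := by
    exact_mod_cast hcard
  linarith

theorem card_le_card_inter_add_card_inter (P S S' T T' : Finset ι) :
    (P.card : ℝ) ≤ (P ∩ (S' ∩ S)).card + (P ∩ (T' ∩ T)).card +
      ((P \ (S ∪ T')).card + (P \ (T ∪ S')).card + (P \ (S ∪ T)).card + (P \ (S' ∪ T')).card) := by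
  have hcover : P ⊆ ((P ∩ (S' ∩ S)) ∪ (P ∩ (T' ∩ T))) ∪
      ((((P \ (S ∪ T')) ∪ (P \ (T ∪ S'))) ∪ (P \ (S ∪ T))) ∪ (P \ (S' ∪ T'))) := by
    intro x hx
    simp only [Finset.mem_union, Finset.mem_sdiff, Finset.mem_inter, hx, true_and]
    tauto
  have hcard := (Finset.card_le_card hcover).trans <| (Finset.card_union_le _ _).trans <|
    Nat.add_le_add (Finset.card_union_le _ _) <| (Finset.card_union_le _ _).trans <|
      Nat.add_le_add_right ((Finset.card_union_le _ _).trans <|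
        Nat.add_le_add_right (Finset.card_union_le _ _) _) _
  exact_mod_cast hcard

end Counting

section Library

variable {N B : ℕ} {α β : Type*}

/-- The law of the library: all the bits are independent and uniform. -/
abbrev libraryLaw (N B : ℕ) : PMF (Library N B) := PMF.uniformOfFintype (Library N B)

/-- The library bits at the positions `T`, as a random variable. -/
def bits (T : Finset (Fin N × Fin B)) (F : Library N B) (x : T) : Bool := F x.1.1 x.1.2

variable {S T : Finset (Fin N × Fin B)} {F F' : Library N B} {f : Fin N}

theorem bits_eq_iff : bits T F = bits T F' ↔ ∀ x ∈ T, F x.1 x.2 = F' x.1 x.2 := by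
  simp [funext_iff, bits]

theorem bits_union_eq_iff :
    bits (S ∪ T) F = bits (S ∪ T) F' ↔ bits S F = bits S F' ∧ bits T F = bits T F' := by
  simp only [bits_eq_iff, Finset.mem_union, or_imp, forall_and]

theorem bits_univ_eq_iff : bits Finset.univ F = bits Finset.univ F' ↔ F = F' := by
  rw [bits_eq_iff]
  simp [funext_iff]

theorem entropy_bits_le (T : Finset (Fin N × Fin B)) :
    entropy (libraryLaw N B) (bits T) ≤ T.card := by
  simpa [Real.logb_pow] using entropy_le_logb_card (libraryLaw N B) (bits T)

theorem entropy_library : entropy (libraryLaw N B) id = N * B := by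
  have hprob : ∀ F, prob (libraryLaw N B) id F = (2 ^ (B * N))⁻¹ := fun F => by
    rw [prob, PMF.map_id, libraryLaw, PMF.uniformOfFintype_apply]
    simp [pow_mul]
  simp only [entropy_eq_expect, id, hprob, expect_const, Real.logb_inv, Real.logb_pow]
  rw [Real.logb_self_eq_one one_lt_two]
  push_cast
  ring

theorem entropy_bits (T : Finset (Fin N × Fin B)) :
    entropy (libraryLaw N B) (bits T) = T.card := by
  refine (entropy_bits_le T).antisymm ?_
  have hsplit : entropy (libraryLaw N B) id ≤
      entropy (libraryLaw N B) (bits T) + entropy (libraryLaw N B) (bits Tᶜ) := by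
    refine le_trans (entropy_congr fun F _ F' _ => ?_).le (entropy_pair_le _ _ _)
    rw [Prod.mk.injEq, ← bits_union_eq_iff, Finset.union_compl, bits_univ_eq_iff, id, id]
  have hcard : (T.card : ℝ) + Tᶜ.card = N * B := by
    exact_mod_cast (Finset.card_add_card_compl T).trans (by simp)
  linarith [entropy_bits_le Tᶜ, entropy_library (N := N) (B := B)]

/-- The positions of the bits of file `f`. -/
def filePos (B : ℕ) {N : ℕ} (f : Fin N) : Finset (Fin N × Fin B) :=
  Finset.univ.filter fun x => x.1 = f

theorem mem_filePos {x : Fin N × Fin B} : x ∈ filePos B f ↔ x.1 = f := by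
  simp [filePos]

theorem card_filePos (f : Fin N) : (filePos B f).card = B := by
  have hprod : filePos B f = {f} ×ˢ (Finset.univ : Finset (Fin B)) := by
    ext ⟨a, b⟩
    simp [mem_filePos, eq_comm]
  simp [hprod]

theorem bits_filePos_eq_iff : bits (filePos B f) F = bits (filePos B f) F' ↔ F f = F' f := by
  rw [bits_eq_iff, funext_iff]
  simp only [mem_filePos, Prod.forall]
  exact ⟨fun h b => h f b rfl, fun h a b hab => hab ▸ h b⟩

theorem card_filePos_sdiff (f : Fin N) (T : Finset (Fin N × Fin B)) :
    ((filePos B f \ T).card : ℝ) =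
      entropy (libraryLaw N B) (bits (filePos B f ∪ T)) - entropy (libraryLaw N B) (bits T) := by
  rw [entropy_bits, entropy_bits, eq_sub_iff_add_eq]
  exact_mod_cast Finset.card_sdiff_add_card (filePos B f) T

/-- What remains unknown of file `f` to a user who knows `Q` and the bits at the positions `S`. -/
def residual (f : Fin N) (Q : Library N B → α) (S : Finset (Fin N × Fin B)) : ℝ :=
  condEntropy (libraryLaw N B) (fun F => F f) (fun F => (Q F, bits S F))

theorem condEntropy_file_bits (f : Fin N) (T : Finset (Fin N × Fin B)) :
    condEntropy (libraryLaw N B) (fun F => F f) (bits T) = (filePos B f \ T).card := by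
  rw [card_filePos_sdiff, condEntropy, sub_left_inj]
  refine entropy_congr fun F _ F' _ => ?_
  rw [Prod.mk.injEq, bits_union_eq_iff, bits_filePos_eq_iff]

theorem residual_nonneg (f : Fin N) (Q : Library N B → α) (S : Finset (Fin N × Fin B)) :
    0 ≤ residual f Q S := condEntropy_nonneg _ _ _

theorem residual_congr {Q : Library N B → α} {Q' : Library N B → β}
    (h : ∀ F F', bits S F = bits S F' → (Q F = Q F' ↔ Q' F = Q' F')) :
    residual f Q S = residual f Q' S :=
  condEntropy_congr_right fun F _ F' _ => by
    simpa only [Prod.mk.injEq] using and_congr_left (h F F')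

theorem card_sdiff_le_residual {Q : Library N B → α}
    (hQ : ∀ F F', bits (S ∪ T) F = bits (S ∪ T) F' → Q F = Q F') :
    ((filePos B f \ (S ∪ T)).card : ℝ) ≤ residual f Q S := by
  rw [← condEntropy_file_bits]
  exact condEntropy_le_condEntropy fun F _ F' _ h =>
    Prod.ext (hQ F F' h) (bits_union_eq_iff.1 h).1

/-- One step of a successive decoding: a receiver who knows the bits at the positions `A` gets the
cache `S` for free, then decodes `f` from `X`; only the part of `f` outside `A ∪ S` is new. -/
theorem condEntropy_bits_step (X : Library N B → α) (A S : Finset (Fin N × Fin B)) (f : Fin N) :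
    (filePos B f \ (A ∪ S)).card - residual f X S +
      condEntropy (libraryLaw N B) X (bits (filePos B f ∪ (A ∪ S))) ≤
        condEntropy (libraryLaw N B) X (bits A) := by
  have hAS : condEntropy (libraryLaw N B) X (bits (A ∪ S)) ≤
      condEntropy (libraryLaw N B) X (bits A) :=
    condEntropy_le_condEntropy fun F _ F' _ h => (bits_union_eq_iff.1 h).1
  have hres : condEntropy (libraryLaw N B) (fun F => F f) (fun F => (X F, bits (A ∪ S) F)) ≤
      residual f X S :=
    condEntropy_le_condEntropy fun F _ F' _ h => by
      rw [Prod.mk.injEq] at h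
      exact Prod.ext h.1 (bits_union_eq_iff.1 h.2).2
  have hchain : entropy (libraryLaw N B) (fun F => (F f, X F, bits (A ∪ S) F)) =
      entropy (libraryLaw N B) (fun F => (X F, bits (filePos B f ∪ (A ∪ S)) F)) :=
    entropy_congr fun F _ F' _ => by
      simp only [Prod.mk.injEq, bits_union_eq_iff (S := filePos B f), bits_filePos_eq_iff,
        and_left_comm]
  rw [card_filePos_sdiff]
  simp only [condEntropy] at hres hAS ⊢
  linarith

theorem sdiff_decoded_eq {S : ℕ → Finset (Fin N × Fin B)} {f : ℕ → Fin N} {m : ℕ}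
    (hf : ∀ j < m, f j ≠ f m) :
    filePos B (f m) \ (((Finset.range m).biUnion fun j => S j ∪ filePos B (f j)) ∪ S m) =
      filePos B (f m) \ (Finset.range (m + 1)).biUnion S := by
  ext x
  simp only [Finset.range_add_one, Finset.biUnion_insert, Finset.mem_sdiff, Finset.mem_union,
    Finset.mem_biUnion, Finset.mem_range, mem_filePos]
  refine and_congr_right fun hx => not_congr ⟨?_, ?_⟩
  · rintro (⟨j, hj, hxj | hxj⟩ | hxm)
    exacts [.inr ⟨j, hj, hxj⟩, (hf j hj (hxj.symm.trans hx)).elim, .inl hxm]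
  · rintro (hxm | ⟨j, hj, hxj⟩)
    exacts [.inr hxm, .inl ⟨j, hj, .inl hxj⟩]

theorem sum_le_entropy_of_decoding (X : Library N B → α) (S : ℕ → Finset (Fin N × Fin B))
    (f : ℕ → Fin N) (n : ℕ) (hf : Set.InjOn f (Set.Iio n)) :
    ∑ i ∈ Finset.range n, ((filePos B (f i) \ (Finset.range (i + 1)).biUnion S).card -
      residual (f i) X (S i)) ≤ entropy (libraryLaw N B) X := by
  set A : ℕ → Finset (Fin N × Fin B) :=
    fun i => (Finset.range i).biUnion fun j => S j ∪ filePos B (f j)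
  have hdecoded : ∀ m ≤ n, ∑ i ∈ Finset.range m,
      (((filePos B (f i) \ (Finset.range (i + 1)).biUnion S).card : ℝ) - residual (f i) X (S i)) +
        condEntropy (libraryLaw N B) X (bits (A m)) ≤ entropy (libraryLaw N B) X := by
    intro m
    induction m with
    | zero => simpa using condEntropy_le_entropy _ _ _
    | succ m ih =>
      intro hm
      have hnew : ∀ j < m, f j ≠ f m := fun j hj h =>
        hj.ne (hf (hj.trans hm) (Set.mem_Iio.2 hm) h)
      have hA : A (m + 1) = filePos B (f m) ∪ (A m ∪ S m) := by
        simp only [A, Finset.range_add_one, Finset.biUnion_insert]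
        ac_rfl
      have hstep := condEntropy_bits_step X (A m) (S m) (f m)
      rw [sdiff_decoded_eq hnew] at hstep
      rw [Finset.sum_range_succ, hA]
      linarith [ih (Nat.le_of_succ_le hm)]
  exact (le_add_of_nonneg_right (condEntropy_nonneg _ _ _)).trans (hdecoded n le_rfl)

/-- Each pair of caches that determines `Q` has to cover `f` up to a residual. If the four pairs
made of `S` or `S'` and of `T` or `T'` cover `f`, then `S` overlaps `S'` or `T` overlaps `T'`. -/
theorem le_card_inter_add_card_inter {Q : Library N B → α} {S T S' T' : Finset (Fin N × Fin B)}
    (hQ : ∀ F F', bits (S ∪ T) F = bits (S ∪ T) F' → Q F = Q F')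
    (hQ₁ : ∀ F F', bits (S ∪ T') F = bits (S ∪ T') F' → Q F = Q F')
    (hQ₂ : ∀ F F', bits (T ∪ S') F = bits (T ∪ S') F' → Q F = Q F') :
    (B : ℝ) - 2 * (residual f Q S + residual f Q T) - (filePos B f \ (S' ∪ T')).card ≤
      (filePos B f ∩ (S' ∩ S)).card + (filePos B f ∩ (T' ∩ T)).card := by
  have hcover := card_le_card_inter_add_card_inter (filePos B f) S S' T T'
  rw [card_filePos] at hcover
  linarith [card_sdiff_le_residual (f := f) hQ, card_sdiff_le_residual (f := f) hQ₁,
    card_sdiff_le_residual (f := f) hQ₂, residual_nonneg f Q T]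

section FixedPackets

variable {X : Library N B → α} {Y : Library N B → β} {S T : ℕ → Finset (Fin N × Fin B)} {n : ℕ}
  {f : ℕ → Fin N}

theorem le_card_uncached_sub_residual (g : Fin N)
    (hX : ∀ i < n, ∀ F F', bits (S i) F = bits (S i) F' → X F = X F')
    (hY : ∀ i < n, ∀ F F', bits (T i) F = bits (T i) F' → Y F = Y F') {i : ℕ} (hi : i < n) :
    ((i : ℝ) + 2) * B -
        (2 * i + 1) * (residual g (fun F => (X F, Y F)) (S i) +
          residual g (fun F => (X F, Y F)) (T i)) -
        ∑ j ∈ Finset.range (i + 1),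
          (((filePos B g ∩ S j).card : ℝ) + (filePos B g ∩ T j).card) -
        ∑ j ∈ Finset.range i, ((filePos B g \ (S j ∪ T j)).card : ℝ) ≤
      ((filePos B g \ (Finset.range (i + 1)).biUnion S).card - residual g Y (S i)) +
      ((filePos B g \ (Finset.range (i + 1)).biUnion T).card - residual g X (T i)) := by
  set Q : Library N B → α × β := fun F => (X F, Y F)
  have hQ : ∀ j < n, ∀ k < n, ∀ F F', bits (S j ∪ T k) F = bits (S j ∪ T k) F' → Q F = Q F' :=
    fun j hj k hk F F' h => Prod.ext (hX j hj F F' (bits_union_eq_iff.1 h).1)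
      (hY k hk F F' (bits_union_eq_iff.1 h).2)
  have hoverlap : ∑ j ∈ Finset.range i, ((B : ℝ) - 2 * (residual g Q (S i) +
      residual g Q (T i)) - (filePos B g \ (S j ∪ T j)).card) ≤
      ∑ j ∈ Finset.range i, (((filePos B g ∩ (S j ∩ S i)).card : ℝ) +
        (filePos B g ∩ (T j ∩ T i)).card) := by
    refine Finset.sum_le_sum fun j hj => ?_
    have hj : j < n := (Finset.mem_range.1 hj).trans hi
    refine le_card_inter_add_card_inter (hQ i hi i hi) (hQ i hi j hj) ?_
    rw [Finset.union_comm]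
    exact hQ j hj i hi
  have hresS : residual g Y (S i) = residual g Q (S i) :=
    residual_congr fun F F' h => by simp [Q, hX i hi F F' h]
  have hresT : residual g X (T i) = residual g Q (T i) :=
    residual_congr fun F F' h => by simp [Q, hY i hi F F' h]
  have hS := card_sub_le_card_sdiff_biUnion (filePos B g) S i
  have hT := card_sub_le_card_sdiff_biUnion (filePos B g) T i
  rw [hresS, hresT, Finset.sum_range_succ]
  simp only [Finset.sum_sub_distrib, Finset.sum_add_distrib, Finset.sum_const, Finset.card_range,
    nsmul_eq_mul, card_filePos] at hoverlap hS hT ⊢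
  linarith

theorem sum_le_entropy_add_entropy (hf : Set.InjOn f (Set.Iio n))
    (hX : ∀ i < n, ∀ F F', bits (S i) F = bits (S i) F' → X F = X F')
    (hY : ∀ i < n, ∀ F F', bits (T i) F = bits (T i) F' → Y F = Y F') :
    ∑ j ∈ Finset.range n,
      (((j : ℝ) + 2) * B -
        (2 * j + 1) * (residual (f j) (fun F => (X F, Y F)) (S j) +
          residual (f j) (fun F => (X F, Y F)) (T j)) -
        ∑ i ∈ Finset.Ico j n, (((filePos B (f i) ∩ S j).card : ℝ) + (filePos B (f i) ∩ T j).card) -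
        ∑ i ∈ Finset.Ico (j + 1) n, ((filePos B (f i) \ (S j ∪ T j)).card : ℝ)) ≤
      entropy (libraryLaw N B) X + entropy (libraryLaw N B) Y := by
  have hfile := Finset.sum_le_sum fun i hi =>
    le_card_uncached_sub_residual (f i) hX hY (Finset.mem_range.1 hi)
  rw [Finset.sum_add_distrib] at hfile
  refine le_trans (le_of_eq ?_) (hfile.trans ((add_le_add
    (sum_le_entropy_of_decoding Y S f n hf) (sum_le_entropy_of_decoding X T f n hf)).trans_eq
      (add_comm _ _)))
  simp only [Finset.sum_sub_distrib, Finset.range_eq_Ico]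
  rw [Finset.sum_Ico_Ico_comm, Finset.sum_Ico_Ico_comm']

end FixedPackets

end Library

theorem mul_le_expect {Ω : Type*} [Fintype Ω] {μ : PMF Ω} {g : Ω → ℝ} (hg : ∀ ω, 0 ≤ g ω)
    (ω : Ω) : (μ ω).toReal * g ω ≤ expect μ g :=
  Finset.single_le_sum (fun ω _ => mul_nonneg ENNReal.toReal_nonneg (hg ω)) (Finset.mem_univ ω)

/-- No coupling of the laws `μ j` is needed: for every `p`, the `c` that maximizes `G j (c, p)` may
be chosen separately for every `j`. -/
theorem sum_expect_le_of_map_snd_eq {C P ι : Type*} [Fintype C] [Fintype P] [Nonempty ι]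
    {s : Finset ι} {μ : ι → PMF (C × P)} {q : PMF P} (hq : ∀ j, (μ j).map Prod.snd = q)
    {G : ι → C × P → ℝ} {A : P → ℝ} (hA : ∀ p (c : ι → C), (∀ j, (c j, p) ∈ (μ j).support) →
      ∑ j ∈ s, G j (c j, p) ≤ A p) :
    ∑ j ∈ s, expect (μ j) (G j) ≤ expect q A := by
  have hmax : ∀ j, ∀ p ∈ q.support, ∃ c, (c, p) ∈ (μ j).support ∧
      ∀ c', (c', p) ∈ (μ j).support → G j (c', p) ≤ G j (c, p) := fun j p hp => by
    rw [← hq j, PMF.mem_support_map_iff] at hp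
    obtain ⟨⟨c, p⟩, hc, rfl⟩ := hp
    exact Set.exists_max_image {c | (c, p) ∈ (μ j).support} (fun c => G j (c, p))
      (Set.toFinite _) ⟨c, hc⟩
  have : Nonempty C := ⟨((μ (Classical.arbitrary ι)).support_nonempty.some).1⟩
  choose! best hbest hle using hmax
  calc ∑ j ∈ s, expect (μ j) (G j)
      ≤ ∑ j ∈ s, expect (μ j) ((fun p => G j (best j p, p)) ∘ Prod.snd) :=
        Finset.sum_le_sum fun j _ => expect_mono fun x hx => hle j x.2
          (hq j ▸ (PMF.mem_support_map_iff _ _ _).2 ⟨x, hx, rfl⟩) x.1 hx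
    _ = expect q fun p => ∑ j ∈ s, G j (best j p, p) := by
        simp only [← expect_map, hq, expect_sum]
    _ ≤ expect q A := expect_mono fun p hp => hA p _ fun j => hbest j p hp

namespace Scheme

variable {K N B : ℕ} (S : Scheme K N B) (dl : PMF (Demands K N))

/-- The metadata of a system: of all the caches, then of all the packets. -/
abbrev Metadata : Type := (∀ k, S.CacheMeta k) × ∀ k, S.PacketMeta k

/-- The joint law of the cache metadata and the packet metadata, given the demands `d`. -/
def metaLaw (d : Demands K N) : PMF S.Metadata :=
  S.placement.bind fun c => (S.query d c).map (Prod.mk c)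

/-- What user `k` sees of the cache and packet metadata. -/
def view (k : Fin K) (m : S.Metadata) : S.CacheMeta k × ∀ k, S.PacketMeta k :=
  (m.1 k, m.2)

/-- The outcome made of given metadata, demands and library. -/
def outcome (x : Demands K N × S.Metadata) (F : Library N B) : S.Outcome :=
  (x.2.1, x.1, x.2.2, F)

theorem signals_outcome_eq_iff {x : Demands K N × S.Metadata} {F F' : Library N B} :
    S.signals (S.outcome x F) = S.signals (S.outcome x F') ↔
      (fun i => S.payload i (x.2.2 i) F) = fun i => S.payload i (x.2.2 i) F' := by
  simp [funext_iff, signals, signal, outcome]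

theorem law_eq_bind : S.law dl = (dl.bind fun d => (S.metaLaw d).map (Prod.mk d)).bind fun x =>
    (libraryLaw N B).map (S.outcome x) := by
  simp only [law, metaLaw, PMF.bind_bind, PMF.bind_map, PMF.map_bind, PMF.map_comp]
  exact PMF.bind_comm _ _ _

theorem mem_support_law {d : Demands K N} (hd : d ∈ dl.support)
    {m : S.Metadata} (hm : m ∈ (S.metaLaw d).support)
    (F : Library N B) : S.outcome (d, m) F ∈ (S.law dl).support := by
  simp only [law_eq_bind, PMF.mem_support_bind_iff, PMF.mem_support_map_iff]
  exact ⟨(d, m), ⟨d, hd, m, hm, rfl⟩, F, by simp, rfl⟩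

theorem map_demand_view {α : Type} (k : Fin K)
    (g : S.CacheMeta k × (∀ i, S.PacketMeta i) → Library N B → α) :
    (S.law dl).map (fun ω => (S.demand ω, g (S.view k (ω.1, ω.2.2.1)) ω.2.2.2)) =
      dl.bind fun d => (((S.metaLaw d).map (S.view k)).bind fun y =>
        (libraryLaw N B).map (g y)).map (Prod.mk d) := by
  simp only [law_eq_bind, PMF.map_bind, PMF.bind_bind, PMF.bind_map, Function.comp_def,
    PMF.map_comp]
  rfl

theorem map_fst_metaLaw (d : Demands K N) : (S.metaLaw d).map Prod.fst = S.placement := by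
  have hconst : ∀ c : ∀ k, S.CacheMeta k,
      Prod.fst ∘ Prod.mk c = Function.const (∀ k, S.PacketMeta k) c := fun _ => rfl
  simp only [metaLaw, PMF.map_bind, PMF.map_comp, hconst, PMF.map_const, PMF.bind_pure]

theorem expect_metaLaw_fst (d : Demands K N) (g : (∀ k, S.CacheMeta k) → ℝ) :
    expect (S.metaLaw d) (fun m => g m.1) = expect S.placement g := by
  rw [← S.map_fst_metaLaw d, expect_map]
  rfl

theorem expect_demand_metaLaw (g : Demands K N × S.Metadata → ℝ) :
    expect (dl.bind fun d => (S.metaLaw d).map (Prod.mk d)) g =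
      expect dl fun d => expect (S.metaLaw d) fun m => g (d, m) := by
  simp only [expect_bind, expect_map, Function.comp_def]

variable {S dl} {α β : Type*}

theorem expect_condEntropy_le_condEntropy_law (X : S.Outcome → α) (Y : S.Outcome → β) :
    (expect dl fun d => expect (S.metaLaw d) fun m =>
      condEntropy (libraryLaw N B) (X ∘ S.outcome (d, m)) (Y ∘ S.outcome (d, m))) ≤
      condEntropy (S.law dl) X Y := by
  rw [law_eq_bind]
  refine le_trans (le_of_eq ?_) (expect_condEntropy_le
    (M := fun ω : S.Outcome => (ω.2.1, ω.1, ω.2.2.1)) (fun x ω hω => ?_) X Y)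
  · simp only [expect_demand_metaLaw, condEntropy, entropy_map]
    rfl
  · obtain ⟨F, -, rfl⟩ := (PMF.mem_support_map_iff _ _ _).1 hω
    rfl

theorem expect_entropy_le_entropy_law (X : S.Outcome → α) :
    (expect dl fun d => expect (S.metaLaw d) fun m =>
      entropy (libraryLaw N B) (X ∘ S.outcome (d, m))) ≤ entropy (S.law dl) X := by
  simpa only [Function.comp_def, condEntropy_const] using
    expect_condEntropy_le_condEntropy_law (dl := dl) X fun _ => ()

/-- The content of user `k` with metadata `c` carries the same information as the library bits at
the positions `T k c`. -/
def StoresAt (S : Scheme K N B) (T : ∀ k, S.CacheMeta k → Finset (Fin N × Fin B)) : Prop :=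
  ∀ k c F F', S.content k c F = S.content k c F' ↔ bits (T k c) F = bits (T k c) F'

theorem IsUncoded.exists_storesAt (hS : S.IsUncoded) : ∃ T, S.StoresAt T := by
  choose l hl using hS
  refine ⟨fun k c => (l k c).toFinset, fun k c F F' => ?_⟩
  rw [hl, hl, List.map_inj_left, bits_eq_iff]
  simp only [List.mem_toFinset]

variable {M R ε : ℝ} {T : ∀ k, S.CacheMeta k → Finset (Fin N × Fin B)}

theorem IsValid.map_view_eq (h : S.IsValid dl M R ε) {k : Fin K} {d d' : Demands K N}
    (hd : d ∈ dl.support) (hd' : d' ∈ dl.support) (hk : d k = d' k) :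
    (S.metaLaw d).map (S.view k) = (S.metaLaw d').map (S.view k) := by
  have hprivate : condMutualInfo (S.law dl) S.demand (fun ω => S.view k (ω.1, ω.2.2.1))
      (fun ω => S.demand ω k) = 0 :=
    le_antisymm ((condMutualInfo_comp_le (S.law dl) S.demand
      (fun ω => (S.signals ω, S.cache k ω)) (fun ω => S.demand ω k)
      fun y => (y.2.1, fun i => (y.1 i).1)).trans_eq (h.privacy k)) (condMutualInfo_nonneg _ _ _ _)
  have hlaw := (condMutualInfo_eq_zero_iff_of_map_eq (S.map_demand_view dl k fun y _ => y)
    fun d => d k).1 hprivate d hd d' hd' hk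
  have hconst : ∀ y : S.CacheMeta k × ∀ i, S.PacketMeta i,
      (libraryLaw N B).map (fun _ => y) = PMF.pure y := PMF.map_const _
  simpa only [hconst, PMF.bind_pure] using hlaw

theorem IsValid.payload_eq (h : S.IsValid dl M R ε) (hT : S.StoresAt T) {d : Demands K N}
    (hd : d ∈ dl.support) {m : S.Metadata}
    (hm : m ∈ (S.metaLaw d).support) (k : Fin K) (F F' : Library N B)
    (hF : bits (T k (m.1 k)) F = bits (T k (m.1 k)) F') :
    S.payload k (m.2 k) F = S.payload k (m.2 k) F' := by
  have hcache : S.cache k (S.outcome (d, m) F) = S.cache k (S.outcome (d, m) F') :=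
    Prod.ext rfl ((hT k (m.1 k) F F').2 hF)
  have hsignal := condEntropy_eq_zero_iff.1 (h.encoding k) _ (S.mem_support_law dl hd hm F)
    _ (S.mem_support_law dl hd hm F') (Prod.ext rfl hcache)
  exact (Prod.ext_iff.1 hsignal).2

theorem IsValid.expect_card_le (h : S.IsValid dl M R ε) (hT : S.StoresAt T) (k : Fin K) :
    expect S.placement (fun c => ((T k (c k)).card : ℝ)) ≤ B * (M + ε) := by
  refine le_trans (le_of_eq ?_) ((expect_entropy_le_entropy_law (S.cache k)).trans (h.cache_size k))
  have hcard : ∀ x, entropy (libraryLaw N B) (S.cache k ∘ S.outcome x) =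
      (T k (x.2.1 k)).card := fun x => by
    rw [← entropy_bits]
    refine entropy_congr fun F _ F' _ => ?_
    simp only [Function.comp_apply, cache, outcome, Prod.mk.injEq, true_and, hT k _ F F']
  have hmarginal : ∀ d, expect (S.metaLaw d) (fun m => ((T k (m.1 k)).card : ℝ)) =
      expect S.placement fun c => ((T k (c k)).card : ℝ) := fun d =>
    S.expect_metaLaw_fst d fun c => ((T k (c k)).card : ℝ)
  simp only [hcard, hmarginal, expect_const]

theorem IsValid.expect_payload_le (h : S.IsValid dl M R ε) {q : PMF (∀ k, S.PacketMeta k)}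
    (hq : ∀ d, (S.metaLaw d).map Prod.snd = q) :
    expect q (fun p => ∑ k, entropy (libraryLaw N B) (S.payload k (p k))) ≤ B * (R + ε) := by
  refine le_trans ?_ h.load
  rw [expect_sum]
  refine Finset.sum_le_sum fun k _ => le_trans (le_of_eq ?_)
    (expect_entropy_le_entropy_law (S.signal k))
  have hpayload : ∀ x, entropy (libraryLaw N B) (S.signal k ∘ S.outcome x) =
      entropy (libraryLaw N B) (S.payload k (x.2.2 k)) := fun x =>
    entropy_congr fun F _ F' _ => by simp [signal, outcome]
  have hmarginal : ∀ d, expect (S.metaLaw d) (fun m =>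
      entropy (libraryLaw N B) (S.payload k (m.2 k))) =
      expect q fun p => entropy (libraryLaw N B) (S.payload k (p k)) := fun d => by
    rw [← hq d, expect_map]
    rfl
  simp only [hpayload, hmarginal, expect_const]

theorem IsValid.mul_expect_residual_le (h : S.IsValid dl M R ε) (hT : S.StoresAt T)
    (d : Demands K N) (k : Fin K) :
    (dl d).toReal * expect (S.metaLaw d) (fun m =>
      residual (d k) (fun F i => S.payload i (m.2 i) F) (T k (m.1 k))) ≤ B * ε := by
  refine le_trans (mul_le_expect (g := fun d => expect (S.metaLaw d) fun m =>
    residual (d k) (fun F i => S.payload i (m.2 i) F) (T k (m.1 k))) (fun d => ?_) d)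
    (le_trans (le_of_eq ?_) ((expect_condEntropy_le_condEntropy_law _ _).trans (h.decoding k)))
  · exact Finset.sum_nonneg fun m _ =>
      mul_nonneg ENNReal.toReal_nonneg (residual_nonneg _ _ _)
  · refine congrArg (expect dl) (funext fun d => congrArg (expect _) (funext fun m => ?_))
    refine condEntropy_congr_right fun F _ F' _ => ?_
    simp only [Function.comp_apply, Prod.mk.injEq, signals_outcome_eq_iff]
    simp only [cache, demand, outcome, Prod.mk.injEq, and_true, true_and, hT k (m.1 k) F F']

end Scheme

namespace Scheme

variable {N B : ℕ} {S : Scheme 2 N B} {dl : PMF (Demands 2 N)} {M R ε δ : ℝ}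
  {T : ∀ k, S.CacheMeta k → Finset (Fin N × Fin B)}

/-- A demand vector that agrees with `d` for the first user and with `d'` for the second one links
the two laws. -/
theorem IsValid.map_snd_metaLaw_eq (h : S.IsValid dl M R ε) (hdl : ∀ d, d ∈ dl.support)
    (d d' : Demands 2 N) : (S.metaLaw d).map Prod.snd = (S.metaLaw d').map Prod.snd := by
  have hview : ∀ k (d d' : Demands 2 N), d k = d' k →
      (S.metaLaw d).map Prod.snd = (S.metaLaw d').map Prod.snd := fun k d d' hk => by
    have hmap := congrArg (PMF.map Prod.snd) (h.map_view_eq (hdl d) (hdl d') hk)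
    rwa [PMF.map_comp, PMF.map_comp] at hmap
  exact (hview 0 d ![d 0, d' 1] rfl).trans (hview 1 ![d 0, d' 1] d' rfl)

theorem IsValid.expect_residual_le (h : S.IsValid dl M R ε) (hT : S.StoresAt T) (hδ : 0 < δ)
    (hdl : ∀ d, δ ≤ (dl d).toReal) (f : Fin N) (k : Fin 2) :
    expect (S.metaLaw fun _ => f) (fun m => residual f
      (fun F => (S.payload 0 (m.2 0) F, S.payload 1 (m.2 1) F)) (T k (m.1 k))) ≤ B * ε / δ := by
  rw [le_div_iff₀' hδ]
  refine le_trans ?_ (h.mul_expect_residual_le hT (fun _ => f) k)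
  refine mul_le_mul (hdl _) (le_of_eq (congrArg (expect _) (funext fun m => ?_)))
    (Finset.sum_nonneg fun m _ => mul_nonneg ENNReal.toReal_nonneg (residual_nonneg _ _ _))
    ENNReal.toReal_nonneg
  exact residual_congr fun F F' _ => by simp [funext_iff, Fin.forall_fin_two]

theorem IsValid.expect_uncached_le (h : S.IsValid dl M R ε) (hT : S.StoresAt T) (hδ : 0 < δ)
    (hdl : ∀ d, δ ≤ (dl d).toReal) (f : Fin N) :
    expect S.placement (fun c => ((filePos B f \ (T 0 (c 0) ∪ T 1 (c 1))).card : ℝ)) ≤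
      B * ε / δ := by
  rw [← S.expect_metaLaw_fst fun _ => f]
  refine (expect_mono fun m hm => card_sdiff_le_residual fun F F' hF => ?_).trans
    (h.expect_residual_le hT hδ hdl f 0)
  have hd : (fun _ => f) ∈ dl.support := (ENNReal.toReal_pos_iff.1 (hδ.trans_le (hdl _))).1.ne'
  rw [bits_union_eq_iff] at hF
  exact Prod.ext (h.payload_eq hT hd hm 0 F F' hF.1) (h.payload_eq hT hd hm 1 F F' hF.2)

/-- The average number of cached bits of file `f`, over both users. -/
def meanCached (S : Scheme 2 N B) (T : ∀ k, S.CacheMeta k → Finset (Fin N × Fin B))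
    (f : Fin N) : ℝ :=
  expect S.placement fun c =>
    ((filePos B f ∩ T 0 (c 0)).card : ℝ) + (filePos B f ∩ T 1 (c 1)).card

theorem IsValid.sum_meanCached_le (h : S.IsValid dl M R ε) (hT : S.StoresAt T) :
    ∑ f, S.meanCached T f ≤ 2 * (B * (M + ε)) := by
  have hfiber : ∀ U : Finset (Fin N × Fin B), ∑ f, ((filePos B f ∩ U).card : ℝ) = U.card := by
    intro U
    rw [Finset.card_eq_sum_card_fiberwise (f := Prod.fst) (t := Finset.univ) (by simp),
      Nat.cast_sum]
    refine Finset.sum_congr rfl fun f _ =>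
      congrArg (fun V : Finset (Fin N × Fin B) => (V.card : ℝ)) ?_
    ext x
    simp [mem_filePos, and_comm]
  simp only [meanCached, ← expect_sum, Finset.sum_add_distrib, hfiber, expect_add]
  linarith [h.expect_card_le hT 0, h.expect_card_le hT 1]

/-- What file `f j` contributes to the lower bound on the total entropy of the payloads, for the
metadata `m` and `n` files. -/
def gain (S : Scheme 2 N B) (T : ∀ k, S.CacheMeta k → Finset (Fin N × Fin B)) (f : ℕ → Fin N)
    (n j : ℕ) (m : S.Metadata) : ℝ :=
  ((j : ℝ) + 2) * B -
    (2 * j + 1) *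
      (residual (f j) (fun F => (S.payload 0 (m.2 0) F, S.payload 1 (m.2 1) F)) (T 0 (m.1 0)) +
        residual (f j) (fun F => (S.payload 0 (m.2 0) F, S.payload 1 (m.2 1) F)) (T 1 (m.1 1))) -
    ∑ i ∈ Finset.Ico j n,
      (((filePos B (f i) ∩ T 0 (m.1 0)).card : ℝ) + (filePos B (f i) ∩ T 1 (m.1 1)).card) -
    ∑ i ∈ Finset.Ico (j + 1) n, ((filePos B (f i) \ (T 0 (m.1 0) ∪ T 1 (m.1 1))).card : ℝ)

theorem IsValid.le_expect_gain (h : S.IsValid dl M R ε) (hT : S.StoresAt T) (hδ : 0 < δ)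
    (hdl : ∀ d, δ ≤ (dl d).toReal) (f : ℕ → Fin N) (n j : ℕ) :
    ((j : ℝ) + 2) * B - (2 * j + 1) * (B * ε / δ + B * ε / δ) -
      ∑ i ∈ Finset.Ico j n, S.meanCached T (f i) - ∑ _i ∈ Finset.Ico (j + 1) n, B * ε / δ ≤
      expect (S.metaLaw fun _ => f j) (S.gain T f n j) := by
  have hcached : expect (S.metaLaw fun _ => f j) (fun m => ∑ i ∈ Finset.Ico j n,
      (((filePos B (f i) ∩ T 0 (m.1 0)).card : ℝ) + (filePos B (f i) ∩ T 1 (m.1 1)).card)) =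
      ∑ i ∈ Finset.Ico j n, S.meanCached T (f i) := by
    rw [expect_sum]
    exact Finset.sum_congr rfl fun i _ => S.expect_metaLaw_fst _ fun c =>
      ((filePos B (f i) ∩ T 0 (c 0)).card : ℝ) + (filePos B (f i) ∩ T 1 (c 1)).card
  have huncached : expect (S.metaLaw fun _ => f j) (fun m => ∑ i ∈ Finset.Ico (j + 1) n,
      ((filePos B (f i) \ (T 0 (m.1 0) ∪ T 1 (m.1 1))).card : ℝ)) ≤
      ∑ _i ∈ Finset.Ico (j + 1) n, B * ε / δ := by
    rw [expect_sum]
    exact Finset.sum_le_sum fun i _ => (S.expect_metaLaw_fst _ fun c =>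
      ((filePos B (f i) \ (T 0 (c 0) ∪ T 1 (c 1))).card : ℝ)).trans_le
        (h.expect_uncached_le hT hδ hdl (f i))
  have hresidual := mul_le_mul_of_nonneg_left (add_le_add (h.expect_residual_le hT hδ hdl (f j) 0)
    (h.expect_residual_le hT hδ hdl (f j) 1)) (by positivity : (0 : ℝ) ≤ 2 * j + 1)
  unfold gain
  simp only [expect_sub, expect_const, expect_const_mul]
  rw [expect_add, hcached]
  linarith

theorem IsValid.le_load_of_files (h : S.IsValid dl M R ε) (hT : S.StoresAt T) (hδ : 0 < δ)
    (hdl : ∀ d, δ ≤ (dl d).toReal) {f : ℕ → Fin N} {n : ℕ} (hf : Set.InjOn f (Set.Iio n)) :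
    ∑ j ∈ Finset.range n, (((j : ℝ) + 2) * B - (2 * j + 1) * (B * ε / δ + B * ε / δ) -
      ∑ i ∈ Finset.Ico j n, S.meanCached T (f i) - ∑ _i ∈ Finset.Ico (j + 1) n, B * ε / δ) ≤
      B * (R + ε) := by
  have hsupp : ∀ d, d ∈ dl.support := fun d =>
    (ENNReal.toReal_pos_iff.1 (hδ.trans_le (hdl d))).1.ne'
  have hq : ∀ d, (S.metaLaw d).map Prod.snd = (S.metaLaw fun _ => f 0).map Prod.snd := fun d =>
    h.map_snd_metaLaw_eq hsupp _ _
  have hsum : ∑ j ∈ Finset.range n, expect (S.metaLaw fun _ => f j) (S.gain T f n j) ≤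
      expect ((S.metaLaw fun _ => f 0).map Prod.snd) fun p =>
        ∑ k, entropy (libraryLaw N B) (S.payload k (p k)) := by
    refine sum_expect_le_of_map_snd_eq (fun j => hq fun _ => f j) fun p c hc => ?_
    simp only [Fin.sum_univ_two, gain]
    exact sum_le_entropy_add_entropy (X := S.payload 0 (p 0)) (Y := S.payload 1 (p 1))
      (S := fun j => T 0 (c j 0)) (T := fun j => T 1 (c j 1)) hf
      (fun j _ => h.payload_eq hT (hsupp _) (hc j) 0)
      (fun j _ => h.payload_eq hT (hsupp _) (hc j) 1)
  exact (Finset.sum_le_sum fun j _ => h.le_expect_gain hT hδ hdl f n j).trans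
    (hsum.trans (h.expect_payload_le hq))

theorem sum_range_Ico (n : ℕ) (a : ℕ → ℝ) :
    ∑ j ∈ Finset.range n, ∑ i ∈ Finset.Ico j n, a i =
      ∑ i ∈ Finset.range n, ((i : ℝ) + 1) * a i := by
  rw [Finset.range_eq_Ico, Finset.sum_Ico_Ico_comm]
  simp

theorem sum_range_add_one (n : ℕ) :
    ∑ i ∈ Finset.range n, ((i : ℝ) + 1) = n * (n + 1) / 2 := by
  induction n with
  | zero => simp
  | succ n ih => rw [Finset.sum_range_succ, ih]; push_cast; ring

theorem injOn_ofNat_add [NeZero N] (s : Fin N) {n : ℕ} (hn : n ≤ N) :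
    Set.InjOn (fun i => Fin.ofNat N i + s) (Set.Iio n) := fun i hi j hj hij => by
  have hval := congrArg Fin.val (add_right_cancel hij)
  simp only [Fin.ofNat] at hval
  rwa [Nat.mod_eq_of_lt ((Set.mem_Iio.1 hi).trans_le hn),
    Nat.mod_eq_of_lt ((Set.mem_Iio.1 hj).trans_le hn)] at hval

/-- The constant `5` is not optimized: it only has to absorb slacks of order `ε B`. -/
theorem IsValid.le_load_of_shift [NeZero N] (h : S.IsValid dl M R ε) (hT : S.StoresAt T)
    (hδ : 0 < δ) (hdl : ∀ d, δ ≤ (dl d).toReal) (hε : 0 ≤ ε) {n : ℕ} (hn : n ≤ N) (s : Fin N) :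
    (n : ℝ) * (n + 3) / 2 * B - 5 * n ^ 2 * (B * ε / δ) -
      ∑ i ∈ Finset.range n, ((i : ℝ) + 1) * S.meanCached T (Fin.ofNat N i + s) ≤
      B * (R + ε) := by
  have hη : 0 ≤ B * ε / δ := by positivity
  have hgauss : ∑ j ∈ Finset.range n, (((j : ℝ) + 2) * B - 5 * n * (B * ε / δ)) =
      n * (n + 3) / 2 * B - 5 * n ^ 2 * (B * ε / δ) := by
    have hterm : ∀ j : ℕ, ((j : ℝ) + 2) * B - 5 * n * (B * ε / δ) =
        ((j : ℝ) + 1) * B + (B - 5 * n * (B * ε / δ)) := fun j => by ring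
    rw [Finset.sum_congr rfl fun j _ => hterm j, Finset.sum_add_distrib, ← Finset.sum_mul,
      sum_range_add_one, Finset.sum_const, Finset.card_range, nsmul_eq_mul]
    ring
  refine le_trans ?_ (h.le_load_of_files hT hδ hdl (injOn_ofNat_add s hn))
  rw [← hgauss, ← sum_range_Ico n fun i => S.meanCached T (Fin.ofNat N i + s),
    ← Finset.sum_sub_distrib]
  refine Finset.sum_le_sum fun j hj => ?_
  have hjn : (j : ℝ) + 1 ≤ n := by exact_mod_cast Finset.mem_range.1 hj
  have huncached : ∑ _i ∈ Finset.Ico (j + 1) n, B * ε / δ ≤ n * (B * ε / δ) := by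
    rw [Finset.sum_const, nsmul_eq_mul, Nat.card_Ico]
    exact mul_le_mul_of_nonneg_right (by exact_mod_cast Nat.sub_le _ _) hη
  have hresidual : (2 * (j : ℝ) + 1) * (B * ε / δ + B * ε / δ) ≤
      2 * n * (B * ε / δ + B * ε / δ) :=
    mul_le_mul_of_nonneg_right (by linarith) (by positivity)
  linarith

theorem IsValid.le_load (h : S.IsValid dl M R ε) (hu : S.IsUncoded) (hδ : 0 < δ)
    (hdl : ∀ d, δ ≤ (dl d).toReal) (hε : 0 ≤ ε) (hN : 0 < N) {n : ℕ} (hn : n ≤ N) :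
    (N : ℝ) * (n * (n + 3) / 2 * B - 5 * n ^ 2 * (B * ε / δ)) - n * (n + 1) * (B * (M + ε)) ≤
      N * (B * (R + ε)) := by
  obtain ⟨T, hT⟩ := hu.exists_storesAt
  have : NeZero N := ⟨hN.ne'⟩
  -- Summing over all cyclic shifts of the files makes every file occur equally often.
  have hsum := Finset.sum_le_sum fun s (_ : s ∈ Finset.univ) =>
    h.le_load_of_shift hT hδ hdl hε hn s
  have hshift : ∀ i : ℕ, ∑ s : Fin N, ((i : ℝ) + 1) * S.meanCached T (Fin.ofNat N i + s) =
      ((i : ℝ) + 1) * ∑ f, S.meanCached T f := fun i => by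
    rw [← Finset.mul_sum]
    exact congrArg _ (Equiv.sum_comp (Equiv.addLeft (Fin.ofNat N i)) (S.meanCached T))
  rw [Finset.sum_sub_distrib, Finset.sum_comm] at hsum
  simp only [hshift, ← Finset.sum_mul, sum_range_add_one, Finset.sum_const, Finset.card_univ,
    Fintype.card_fin, nsmul_eq_mul] at hsum
  have hcache := mul_le_mul_of_nonneg_left (h.sum_meanCached_le hT)
    (by positivity : (0 : ℝ) ≤ n * (n + 1) / 2)
  linarith

end Scheme

/-- The lower bound on the load at cache size `M` that results from the successive decoding of `n`
of the `N` files. -/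
def converseBound (N n : ℕ) (M : ℝ) : ℝ :=
  (n : ℝ) * (n + 3) / 2 - n * (n + 1) * M / N

theorem AchievableUncoded.converseBound_le {N : ℕ} {dl : PMF (Demands 2 N)} (hfull : ∀ d, dl d ≠ 0)
    {M R : ℝ} (h : AchievableUncoded dl M R) (hN : 0 < N) {n : ℕ} (hn : n ≤ N) :
    converseBound N n M ≤ R := by
  obtain ⟨ε, hε, hlim, hS⟩ := h
  have : NeZero N := ⟨hN.ne'⟩
  obtain ⟨d₀, hd₀⟩ := Finite.exists_min fun d => (dl d).toReal
  set δ := (dl d₀).toReal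
  have hδ : 0 < δ := ENNReal.toReal_pos (hfull d₀) (dl.apply_ne_top d₀)
  have hbound : ∀ B : ℕ, 0 < B → (N : ℝ) * (n * (n + 3) / 2 - 5 * n ^ 2 * (ε B / δ)) -
      n * (n + 1) * (M + ε B) ≤ N * (R + ε B) := fun B hB => by
    obtain ⟨S, hu, hv⟩ := hS B
    refine le_of_mul_le_mul_right ?_ (Nat.cast_pos.2 hB : (0 : ℝ) < B)
    exact (le_of_eq (by ring)).trans
      ((hv.le_load hu hδ hd₀ (hε B) hN hn).trans (le_of_eq (by ring)))
  have hleft : Filter.Tendsto (fun B => (N : ℝ) * (n * (n + 3) / 2 - 5 * n ^ 2 * (ε B / δ)) -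
      n * (n + 1) * (M + ε B)) Filter.atTop
      (nhds ((N : ℝ) * (n * (n + 3) / 2 - 5 * n ^ 2 * (0 / δ)) - n * (n + 1) * (M + 0))) :=
    ((((hlim.div_const δ).const_mul _).const_sub _).const_mul _).sub
      ((hlim.const_add _).const_mul _)
  have hlimit := le_of_tendsto_of_tendsto hleft ((hlim.const_add R).const_mul (N : ℝ))
    (Filter.eventually_atTop.2 ⟨1, hbound⟩)
  simp only [zero_div, mul_zero, sub_zero, add_zero] at hlimit
  refine le_of_mul_le_mul_left (le_trans (le_of_eq ?_) hlimit) (Nat.cast_pos.2 hN : (0 : ℝ) < N)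
  rw [converseBound]
  field_simp

section Entropy

variable {Ω α β γ : Type*} [Fintype Ω] {μ : PMF Ω}

theorem condEntropy_le_entropy_of_eq {X : Ω → α} {Y : Ω → β} {W : Ω → γ}
    (h : ∀ ω ∈ μ.support, ∀ ω' ∈ μ.support, W ω = W ω' → Y ω = Y ω' → X ω = X ω') :
    condEntropy μ X Y ≤ entropy μ W :=
  calc condEntropy μ X Y
      ≤ condEntropy μ W Y := sub_le_sub_right
        (entropy_mono (X := fun ω => (W ω, Y ω)) (Y := fun ω => (X ω, Y ω)) fun ω hω ω' hω' hWY =>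
          have hWY' := Prod.ext_iff.1 hWY
          Prod.ext (h ω hω ω' hω' hWY'.1 hWY'.2) hWY'.2) _
    _ ≤ entropy μ W := condEntropy_le_entropy μ W Y

theorem entropy_list_le {Y : Ω → List Bool} {m : ℕ} (hY : ∀ ω, (Y ω).length = m) :
    entropy μ Y ≤ m := by
  let V : Ω → List.Vector Bool m := fun ω => ⟨Y ω, hY ω⟩
  calc entropy μ Y = entropy μ V := entropy_congr fun _ _ _ _ =>
      ⟨fun h => Subtype.ext h, congrArg Subtype.val⟩
    _ ≤ Real.logb 2 (Fintype.card (List.Vector Bool m)) := entropy_le_logb_card μ V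
    _ = m := by simp [Real.logb_pow]

theorem entropy_pair_list_le [Fintype α] (X : Ω → α) {Y : Ω → List Bool} {m : ℕ}
    (hY : ∀ ω, (Y ω).length = m) :
    entropy μ (fun ω => (X ω, Y ω)) ≤ Real.logb 2 (Fintype.card α) + m :=
  (entropy_pair_le μ X Y).trans (add_le_add (entropy_le_logb_card μ X) (entropy_list_le hY))

end Entropy

namespace Scheme

variable {K N B : ℕ}

/-- A scheme which stores `m k` bits, sends `ℓ k` bits, and decodes all bits of the demanded files
outside `E`, without error. -/
structure IsExact (S : Scheme K N B) (m ℓ : Fin K → ℕ) (E : Finset (Fin B)) : Prop where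
  uncoded : S.IsUncoded
  content_length : ∀ k c F, (S.content k c F).length = m k
  payload_length : ∀ k p F, (S.payload k p F).length = ℓ k
  encode : ∀ k d, ∀ x ∈ (S.metaLaw d).support, ∀ F F',
    S.content k (x.1 k) F = S.content k (x.1 k) F' → S.payload k (x.2 k) F = S.payload k (x.2 k) F'
  decode : ∀ k d, ∀ x ∈ (S.metaLaw d).support, ∀ F F',
    S.content k (x.1 k) F = S.content k (x.1 k) F' →
    (∀ i, S.payload i (x.2 i) F = S.payload i (x.2 i) F') → ∀ b ∉ E, F (d k) b = F' (d k) b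
  map_view_eq : ∀ k d d', d k = d' k →
    (S.metaLaw d).map (S.view k) = (S.metaLaw d').map (S.view k)

variable {S : Scheme K N B} {dl : PMF (Demands K N)} {m ℓ : Fin K → ℕ} {E : Finset (Fin B)}

theorem metadata_mem_support {ω : S.Outcome} (hω : ω ∈ (S.law dl).support) :
    (ω.1, ω.2.2.1) ∈ (S.metaLaw ω.2.1).support := by
  simp only [law_eq_bind, PMF.mem_support_bind_iff, PMF.mem_support_map_iff] at hω
  obtain ⟨-, ⟨d, -, x, hx, rfl⟩, F, -, rfl⟩ := hω
  exact hx

theorem signals_eq_iff {ω ω' : S.Outcome} : S.signals ω = S.signals ω' ↔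
    ω.2.2.1 = ω'.2.2.1 ∧ ∀ i, S.payload i (ω.2.2.1 i) ω.2.2.2 =
      S.payload i (ω'.2.2.1 i) ω'.2.2.2 := by
  simp only [signals, signal, funext_iff, Prod.mk.injEq, forall_and]

theorem IsExact.privacy (h : S.IsExact m ℓ E) (dl : PMF (Demands K N)) (k : Fin K) :
    condMutualInfo (S.law dl) S.demand
      (fun ω => (S.signals ω, S.cache k ω)) (fun ω => S.demand ω k) = 0 :=
  (condMutualInfo_eq_zero_iff_of_map_eq
    (S.map_demand_view dl k fun y F =>
      ((fun i => (y.2 i, S.payload i (y.2 i) F)), (y.1, S.content k y.1 F)))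
    fun d => d k).2 fun d _ d' _ hd => by rw [h.map_view_eq k d d' hd]

theorem IsExact.condEntropy_signal (h : S.IsExact m ℓ E) (dl : PMF (Demands K N)) (k : Fin K) :
    condEntropy (S.law dl) (S.signal k) (fun ω => (S.packetMeta k ω, S.cache k ω)) = 0 := by
  refine condEntropy_eq_zero_iff.2 fun ω hω ω' _ hωω' => ?_
  simp only [packetMeta, cache, Prod.mk.injEq] at hωω'
  obtain ⟨hp, hc, hcontent⟩ := hωω'
  rw [signal, signal, ← hp]
  exact Prod.ext rfl
    (h.encode k ω.2.1 _ (metadata_mem_support hω) _ _ (by rw [hcontent, hc]))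

theorem IsExact.condEntropy_demandedFile_le (h : S.IsExact m ℓ E) (dl : PMF (Demands K N))
    (k : Fin K) : condEntropy (S.law dl) (S.demandedFile k)
      (fun ω => (S.signals ω, S.cache k ω, S.demand ω k)) ≤ E.card := by
  let W : S.Outcome → E → Bool := fun ω b => S.demandedFile k ω b
  refine (condEntropy_le_entropy_of_eq (W := W) fun ω hω ω' _ hW hωω' => ?_).trans
    (by simpa [Real.logb_pow] using entropy_le_logb_card (S.law dl) W)
  simp only [signals_eq_iff, cache, demand, Prod.mk.injEq] at hωω'
  obtain ⟨⟨hp, hpayload⟩, ⟨hc, hcontent⟩, hd⟩ := hωω'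
  funext b
  by_cases hb : b ∈ E
  · exact congrFun hW ⟨b, hb⟩
  · rw [demandedFile, demandedFile, demand, demand, ← hd]
    exact h.decode k ω.2.1 _ (metadata_mem_support hω) _ _ (by rw [hcontent, hc])
      (fun i => by rw [hpayload i, hp]) b hb

theorem IsExact.isValid (h : S.IsExact m ℓ E) {M R ε : ℝ}
    (hm : ∀ k, Real.logb 2 (Fintype.card (S.CacheMeta k)) + m k ≤ B * (M + ε))
    (hℓ : ∑ k, (Real.logb 2 (Fintype.card (S.PacketMeta k)) + ℓ k) ≤ B * (R + ε))
    (hE : E.card ≤ B * ε) (dl : PMF (Demands K N)) : S.IsValid dl M R ε where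
  cache_size k := (entropy_pair_list_le _ fun _ => h.content_length k _ _).trans (hm k)
  encoding := h.condEntropy_signal dl
  decoding k := (h.condEntropy_demandedFile_le dl k).trans hE
  privacy := h.privacy dl
  load := (Finset.sum_le_sum fun k _ =>
    entropy_pair_list_le (fun ω : S.Outcome => ω.2.2.1 k) fun _ => h.payload_length k _ _).trans hℓ

end Scheme

namespace Scheme

variable {K N B₁ B₂ : ℕ}

/-- Memory-sharing: the first `B₁` bits of every file are treated by one scheme, the other `B₂`
bits by another one. -/
def share (S₁ : Scheme K N B₁) (S₂ : Scheme K N B₂) : Scheme K N (B₁ + B₂) where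
  CacheMeta k := S₁.CacheMeta k × S₂.CacheMeta k
  PacketMeta k := S₁.PacketMeta k × S₂.PacketMeta k
  placement := S₁.placement.bind fun c₁ => S₂.placement.map fun c₂ k => (c₁ k, c₂ k)
  content k c F := S₁.content k c.1 (fun f b => F f (Fin.castAdd B₂ b)) ++
    S₂.content k c.2 (fun f b => F f (Fin.natAdd B₁ b))
  query d c := (S₁.query d fun k => (c k).1).bind fun p₁ =>
    (S₂.query d fun k => (c k).2).map fun p₂ k => (p₁ k, p₂ k)
  payload k p F := S₁.payload k p.1 (fun f b => F f (Fin.castAdd B₂ b)) ++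
    S₂.payload k p.2 (fun f b => F f (Fin.natAdd B₁ b))

variable {S₁ : Scheme K N B₁} {S₂ : Scheme K N B₂} {m₁ m₂ ℓ₁ ℓ₂ : Fin K → ℕ}
  {E₁ : Finset (Fin B₁)} {E₂ : Finset (Fin B₂)}

/-- The metadata of a memory-sharing scheme which consist of given metadata of the two schemes. -/
def pairMetadata (x₁ : S₁.Metadata) (x₂ : S₂.Metadata) : (S₁.share S₂).Metadata :=
  (fun k => (x₁.1 k, x₂.1 k), fun k => (x₁.2 k, x₂.2 k))

theorem metaLaw_share (d : Demands K N) : (S₁.share S₂).metaLaw d =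
    (S₁.metaLaw d).bind fun x₁ => (S₂.metaLaw d).map (pairMetadata x₁) := by
  have hmap : ∀ x₁ : S₁.Metadata, (S₂.metaLaw d).map (pairMetadata x₁) =
      S₂.placement.bind fun c₂ => (S₂.query d c₂).map fun p₂ => pairMetadata x₁ (c₂, p₂) :=
    fun x₁ => by
      simp only [metaLaw, PMF.map_bind, PMF.map_comp, Function.comp_def]
  simp only [hmap]
  simp only [metaLaw, share, PMF.map_bind, PMF.map_comp, PMF.bind_bind, PMF.bind_map,
    Function.comp_def]
  exact congrArg _ (funext fun c₁ => PMF.bind_comm _ _ _)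

theorem mem_support_metaLaw_share {d : Demands K N} {x : (S₁.share S₂).Metadata}
    (hx : x ∈ ((S₁.share S₂).metaLaw d).support) :
    ((fun k => (x.1 k).1), fun k => (x.2 k).1) ∈ (S₁.metaLaw d).support ∧
      ((fun k => (x.1 k).2), fun k => (x.2 k).2) ∈ (S₂.metaLaw d).support := by
  rw [metaLaw_share, PMF.mem_support_bind_iff] at hx
  obtain ⟨x₁, hx₁, hx⟩ := hx
  obtain ⟨x₂, hx₂, rfl⟩ := (PMF.mem_support_map_iff _ _ _).1 hx
  exact ⟨hx₁, hx₂⟩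

theorem map_view_metaLaw_share (k : Fin K) (d : Demands K N) :
    ((S₁.share S₂).metaLaw d).map ((S₁.share S₂).view k) =
      ((S₁.metaLaw d).map (S₁.view k)).bind fun y₁ => ((S₂.metaLaw d).map (S₂.view k)).map fun y₂ =>
        ((y₁.1, y₂.1), fun i => (y₁.2 i, y₂.2 i)) := by
  simp only [metaLaw_share, PMF.map_bind, PMF.bind_map, PMF.map_comp, Function.comp_def]
  rfl

theorem IsExact.share (h₁ : S₁.IsExact m₁ ℓ₁ E₁) (h₂ : S₂.IsExact m₂ ℓ₂ E₂) :
    (S₁.share S₂).IsExact (m₁ + m₂) (ℓ₁ + ℓ₂)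
      (E₁.map (Fin.castAddEmb B₂) ∪ E₂.map (Fin.natAddEmb B₁)) where
  uncoded k c := by
    obtain ⟨l₁, hl₁⟩ := h₁.uncoded k c.1
    obtain ⟨l₂, hl₂⟩ := h₂.uncoded k c.2
    refine ⟨l₁.map (fun x => (x.1, Fin.castAdd B₂ x.2)) ++
      l₂.map (fun x => (x.1, Fin.natAdd B₁ x.2)), fun F => ?_⟩
    simp [Scheme.share, hl₁, hl₂, Function.comp_def]
  content_length k c F := by
    simp [Scheme.share, h₁.content_length, h₂.content_length]
  payload_length k p F := by
    simp [Scheme.share, h₁.payload_length, h₂.payload_length]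
  encode k d x hx F F' hF := by
    obtain ⟨hx₁, hx₂⟩ := mem_support_metaLaw_share hx
    obtain ⟨hF₁, hF₂⟩ := List.append_inj hF (by rw [h₁.content_length, h₁.content_length])
    exact congrArg₂ (· ++ ·) (h₁.encode k d _ hx₁ _ _ hF₁) (h₂.encode k d _ hx₂ _ _ hF₂)
  decode k d x hx F F' hF hP b hb := by
    obtain ⟨hx₁, hx₂⟩ := mem_support_metaLaw_share hx
    obtain ⟨hF₁, hF₂⟩ := List.append_inj hF (by rw [h₁.content_length, h₁.content_length])
    have hP' := fun i => List.append_inj (hP i) (by rw [h₁.payload_length, h₁.payload_length])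
    rw [Finset.mem_union, not_or] at hb
    induction b using Fin.addCases with
    | left b =>
      exact h₁.decode k d _ hx₁ _ _ hF₁ (fun i => (hP' i).1) b fun h =>
        hb.1 (Finset.mem_map_of_mem (Fin.castAddEmb B₂) h)
    | right b =>
      exact h₂.decode k d _ hx₂ _ _ hF₂ (fun i => (hP' i).2) b fun h =>
        hb.2 (Finset.mem_map_of_mem (Fin.natAddEmb B₁) h)
  map_view_eq k d d' hd := by
    rw [map_view_metaLaw_share, map_view_metaLaw_share, h₁.map_view_eq k d d' hd,
      h₂.map_view_eq k d d' hd]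

/-- The scheme in which every user caches the whole library. -/
def fullCache (K N B : ℕ) : Scheme K N B where
  CacheMeta _ := Unit
  PacketMeta _ := Unit
  placement := PMF.pure fun _ => ()
  content _ _ F := (Finset.univ : Finset (Fin N × Fin B)).toList.map fun x => F x.1 x.2
  query _ _ := PMF.pure fun _ => ()
  payload _ _ _ := []

theorem isExact_fullCache (K N B : ℕ) :
    (fullCache K N B).IsExact (fun _ => N * B) (fun _ => 0) ∅ where
  uncoded _ _ := ⟨_, fun _ => rfl⟩
  content_length k c F := by simp [fullCache]
  payload_length k p F := rfl
  encode k d x _ F F' _ := rfl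
  decode k d x _ F F' h _ b _ := by
    simp only [fullCache, List.map_inj_left] at h
    exact h (d k, b) (by simp)
  map_view_eq k d d' _ := rfl

end Scheme

/-- The cache sizes of the users and the loads that are reached by exact schemes, up to a bounded
number of bits. -/
def exactRegion (K N : ℕ) : Set ((Fin K → ℝ) × ℝ) :=
  {x | ∃ κ : ℝ, ∀ B : ℕ, ∃ (S : Scheme K N B) (m ℓ : Fin K → ℕ) (E : Finset (Fin B)),
    S.IsExact m ℓ E ∧
    (∀ k, Real.logb 2 (Fintype.card (S.CacheMeta k)) + m k ≤ B * x.1 k + κ) ∧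
    ∑ k, (Real.logb 2 (Fintype.card (S.PacketMeta k)) + ℓ k) ≤ B * x.2 + κ ∧ E.card ≤ κ}

theorem logb_card_cacheMeta_fullCache {K N B : ℕ} (k : Fin K) :
    Real.logb 2 (Fintype.card ((Scheme.fullCache K N B).CacheMeta k)) = 0 := by
  have : Unique ((Scheme.fullCache K N B).CacheMeta k) := inferInstanceAs (Unique Unit)
  simp

theorem logb_card_packetMeta_fullCache {K N B : ℕ} (k : Fin K) :
    Real.logb 2 (Fintype.card ((Scheme.fullCache K N B).PacketMeta k)) = 0 := by
  have : Unique ((Scheme.fullCache K N B).PacketMeta k) := inferInstanceAs (Unique Unit)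
  simp

theorem fullCache_mem_exactRegion (K N : ℕ) :
    ((fun _ => (N : ℝ)), (0 : ℝ)) ∈ exactRegion K N := by
  refine ⟨0, fun B => ⟨_, _, _, _, Scheme.isExact_fullCache K N B, fun k => ?_, ?_, by simp⟩⟩
  · rw [logb_card_cacheMeta_fullCache]
    simp [mul_comm]
  · simp [logb_card_packetMeta_fullCache]

theorem logb_card_prod_le (α β : Type*) [Fintype α] [Fintype β] :
    Real.logb 2 (Fintype.card (α × β)) ≤
      Real.logb 2 (Fintype.card α) + Real.logb 2 (Fintype.card β) := by
  have hnonneg : ∀ n : ℕ, 0 ≤ Real.logb 2 n := fun n =>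
    div_nonneg (Real.log_natCast_nonneg n) (Real.log_nonneg one_le_two)
  rw [Fintype.card_prod, Nat.cast_mul]
  rcases eq_or_ne (Fintype.card α : ℝ) 0 with hα | hα
  · simpa [hα] using hnonneg (Fintype.card β)
  rcases eq_or_ne (Fintype.card β : ℝ) 0 with hβ | hβ
  · simpa [hβ] using hnonneg (Fintype.card α)
  exact (Real.logb_mul hα hβ).le

theorem logb_card_prod_add_le (α β : Type*) [Fintype α] [Fintype β] (m n : ℕ) :
    Real.logb 2 (Fintype.card (α × β)) + (m + n : ℕ) ≤
      (Real.logb 2 (Fintype.card α) + m) + (Real.logb 2 (Fintype.card β) + n) := by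
  rw [Nat.cast_add, add_add_add_comm]
  exact add_le_add_left (logb_card_prod_le α β) _

theorem floor_mul_add_le {a b u v : ℝ} (ha : 0 ≤ a) (hab : a + b = 1) {B B₁ B₂ : ℕ}
    (hB₁ : B₁ = ⌊a * B⌋₊) (hB : B = B₁ + B₂) :
    B₁ * u + B₂ * v ≤ B * (a * u + b * v) + (|u| + |v|) := by
  have hfloor := Nat.floor_le (by positivity : 0 ≤ a * B)
  have hlt := Nat.lt_floor_add_one (a * B)
  rw [← hB₁] at hfloor hlt
  have hBB : (B : ℝ) = B₁ + B₂ := by exact_mod_cast hB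
  calc B₁ * u + B₂ * v
      = B * (a * u + b * v) + (a * B - B₁) * (v - u) := by
        rw [eq_sub_of_add_eq' hab, ← sub_eq_iff_eq_add'.2 hBB]
        ring
    _ ≤ B * (a * u + b * v) + 1 * |v - u| := by
        refine add_le_add_right ((le_abs_self _).trans ?_) _
        rw [abs_mul, abs_of_nonneg (sub_nonneg.2 hfloor)]
        gcongr
        linarith
    _ ≤ B * (a * u + b * v) + (|u| + |v|) := by
        rw [one_mul, abs_sub_comm]
        exact add_le_add_right (abs_sub u v) _

theorem convex_exactRegion (K N : ℕ) : Convex ℝ (exactRegion K N) := by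
  rintro x ⟨κ, hx⟩ y ⟨κ', hy⟩ a b ha hb hab
  let D : ℝ := ∑ k, (|x.1 k| + |y.1 k|) + (|x.2| + |y.2|)
  have hDcache : ∀ k, |x.1 k| + |y.1 k| ≤ D := fun k =>
    (Finset.single_le_sum (f := fun k => |x.1 k| + |y.1 k|) (fun _ _ => by positivity)
      (Finset.mem_univ k)).trans (le_add_of_nonneg_right (by positivity))
  have hDload : |x.2| + |y.2| ≤ D := le_add_of_nonneg_left (by positivity)
  refine ⟨κ + κ' + D, fun B => ?_⟩
  obtain ⟨B₁, hB₁⟩ : ∃ B₁, B₁ = ⌊a * B⌋₊ := ⟨_, rfl⟩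
  have hle : B₁ ≤ B := hB₁ ▸ Nat.floor_le_of_le
    (mul_le_of_le_one_left (Nat.cast_nonneg B) (by linarith))
  obtain ⟨B₂, rfl⟩ := Nat.exists_eq_add_of_le hle
  obtain ⟨S₁, m₁, ℓ₁, E₁, hS₁, hm₁, hℓ₁, hE₁⟩ := hx B₁
  obtain ⟨S₂, m₂, ℓ₂, E₂, hS₂, hm₂, hℓ₂, hE₂⟩ := hy B₂
  refine ⟨S₁.share S₂, _, _, _, hS₁.share hS₂, fun k => ?_, ?_, ?_⟩
  · have hfloor := floor_mul_add_le (u := x.1 k) (v := y.1 k) ha hab hB₁ rfl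
    calc _ ≤ _ := logb_card_prod_add_le (S₁.CacheMeta k) (S₂.CacheMeta k) (m₁ k) (m₂ k)
      _ ≤ (B₁ + B₂ : ℕ) * (a * x.1 k + b * y.1 k) + (κ + κ' + D) := by
          linarith [hm₁ k, hm₂ k, hDcache k]
  · have hfloor := floor_mul_add_le (u := x.2) (v := y.2) ha hab hB₁ rfl
    calc _ ≤ _ := Finset.sum_le_sum fun k _ =>
          logb_card_prod_add_le (S₁.PacketMeta k) (S₂.PacketMeta k) (ℓ₁ k) (ℓ₂ k)
      _ ≤ (B₁ + B₂ : ℕ) * (a * x.2 + b * y.2) + (κ + κ' + D) := by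
          rw [Finset.sum_add_distrib]
          linarith
  · calc ((E₁.map (Fin.castAddEmb B₂) ∪ E₂.map (Fin.natAddEmb B₁)).card : ℝ)
        ≤ E₁.card + E₂.card := by
          exact_mod_cast (Finset.card_union_le _ _).trans_eq (by simp only [Finset.card_map])
      _ ≤ κ + κ' + D := by
          linarith [abs_nonneg x.2, abs_nonneg y.2]

theorem achievableUncoded_of_mem_exactRegion {K N : ℕ} (dl : PMF (Demands K N)) {M R : ℝ}
    (h : ((fun _ => M), R) ∈ exactRegion K N) : AchievableUncoded dl M R := by
  obtain ⟨κ, hκ⟩ := h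
  have hκ0 : 0 ≤ κ := by
    obtain ⟨_, _, _, _, -, -, -, hE⟩ := hκ 0
    exact (Nat.cast_nonneg _).trans hE
  refine ⟨fun B => κ / B, fun B => by positivity, tendsto_const_div_atTop_nhds_zero_nat κ,
    fun B => ?_⟩
  rcases Nat.eq_zero_or_pos B with rfl | hB
  · -- The slack `κ / 0` is zero here, hence a scheme without metadata is needed.
    exact ⟨_, (Scheme.isExact_fullCache K N 0).uncoded, (Scheme.isExact_fullCache K N 0).isValid
      (fun k => by simp [logb_card_cacheMeta_fullCache])
      (by simp [logb_card_packetMeta_fullCache]) (by simp) dl⟩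
  · obtain ⟨S, m, ℓ, E, hS, hm, hℓ, hE⟩ := hκ B
    have hslack : (B : ℝ) * (κ / B) = κ := mul_div_cancel₀ κ (by positivity)
    exact ⟨S, hS.uncoded, hS.isValid (fun k => by rw [mul_add, hslack]; exact hm k)
      (by rw [mul_add, hslack]; exact hℓ) (by rw [hslack]; exact hE) dl⟩

/-- The combinatorial data of a private delivery from one user to the other: files are cut into `q`
pieces, and for every set of `r` files, a sum of one piece of each of these files is sent. -/
structure Design (N r q : ℕ) where
  /-- the labels of the cached pieces -/
  cached : Finset (Fin q)
  /-- the label of the piece of file `f` that is used in the message for `s` -/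
  slot : Fin N → {s : Finset (Fin N) // s.card = r} → Fin q
  /-- the relabelling of the pieces of file `f` when file `i` is demanded -/
  shift : Fin N → Fin N → Equiv.Perm (Fin q)
  shift_mem : ∀ i f s, i ∈ s.1 → f ∈ s.1 → f ≠ i → shift i f (slot f s) ∈ cached
  exists_of_notMem : ∀ i j, j ∉ cached → ∃ s, i ∈ s.1 ∧ shift i i (slot i s) = j

theorem exists_perm_image_eq {α : Type*} [Finite α] [DecidableEq α] {U V : Finset α}
    (h : U.card = V.card) : ∃ σ : Equiv.Perm α, U.image σ = V := by
  let e : {x // x ∈ U} ≃ {x // x ∈ V} := Finset.equivOfCardEq h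
  have hmaps : U.image e.extendSubtype ⊆ V :=
    Finset.image_subset_iff.2 fun x hx => e.extendSubtype_mem x hx
  exact ⟨e.extendSubtype, Finset.eq_of_subset_of_card_le hmaps
    (by rw [Finset.card_image_of_injective _ (Equiv.injective _), h])⟩

theorem card_filter_subtype_card_eq {α : Type*} [Fintype α] (r : ℕ) (p : Finset α → Prop)
    [DecidablePred p] : (Finset.univ.filter fun s : {s : Finset α // s.card = r} => p s.1).card =
      ((Finset.univ.powersetCard r).filter p).card := by
  rw [← Finset.card_map (Function.Embedding.subtype _)]
  congr 1
  ext s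
  simp [Finset.mem_powersetCard, and_comm]

theorem card_sets_mem {N : ℕ} (t : ℕ) (f : Fin N) :
    (Finset.univ.filter fun s : {s : Finset (Fin N) // s.card = t + 1} => f ∈ s.1).card =
      (N - 1).choose t := by
  simpa [card_filter_subtype_card_eq (t + 1) (f ∈ ·)] using
    Finset.card_filter_powersetCard_subset {f} Finset.univ (t + 1) (Finset.subset_univ _) (by simp)

theorem card_sets_mem_notMem {N : ℕ} (t : ℕ) {f i : Fin N} (hfi : f ≠ i) :
    (Finset.univ.filter fun s : {s : Finset (Fin N) // s.card = t + 1} =>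
      f ∈ s.1 ∧ i ∉ s.1).card = (N - 2).choose t := by
  have hfilter : (Finset.univ.powersetCard (t + 1)).filter (fun s => f ∈ s ∧ i ∉ s) =
      ((Finset.univ.erase i).powersetCard (t + 1)).filter ({f} ⊆ ·) := by
    ext s
    simp only [Finset.mem_filter, Finset.mem_powersetCard, Finset.subset_erase,
      Finset.subset_univ, Finset.singleton_subset_iff]
    tauto
  rw [card_filter_subtype_card_eq (t + 1) (fun s => f ∈ s ∧ i ∉ s), hfilter,
    Finset.card_filter_powersetCard_subset _ _ _ (by simpa using hfi) (by simp)]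
  simp [Nat.sub_sub]

theorem card_sets_mem_mem {N : ℕ} (t : ℕ) {f i : Fin N} (hfi : f ≠ i) :
    (Finset.univ.filter fun s : {s : Finset (Fin N) // s.card = t + 1} =>
      f ∈ s.1 ∧ i ∈ s.1).card = (N - 1).choose t - (N - 2).choose t := by
  rw [← card_sets_mem t f, ← card_sets_mem_notMem t hfi, ← Finset.filter_filter,
    ← Finset.filter_filter]
  exact Nat.eq_sub_of_add_eq (Finset.card_filter_add_card_filter_not _)

theorem exists_injOn_of_card_le {α β : Type*} [Fintype β] [Nonempty β] {s : Finset α}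
    (hs : s.card ≤ Fintype.card β) : ∃ e : α → β, Set.InjOn e s := by
  obtain ⟨e, -, he⟩ := s.finite_toSet.exists_injOn_of_encard_le (t := (Set.univ : Set β))
    (by simpa using hs)
  exact ⟨e, he⟩

theorem exists_design {N t : ℕ} (ht : t < N) :
    ∃ D : Design N (t + 1) ((N - 1).choose t + ((N - 1).choose t - (N - 2).choose t)),
      D.cached.card = (N - 1).choose t - (N - 2).choose t := by
  classical
  set a := (N - 1).choose t - (N - 2).choose t
  set q := (N - 1).choose t + a with hq
  have : NeZero q := ⟨(Nat.add_pos_left (Nat.choose_pos (by omega)) _).ne'⟩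
  obtain ⟨A, -, hA⟩ := Finset.exists_subset_card_eq (s := (Finset.univ : Finset (Fin q))) (n := a)
    (by simp [hq])
  choose slot hslot using fun f : Fin N => exists_injOn_of_card_le (β := Fin q)
    (s := Finset.univ.filter fun s : {s : Finset (Fin N) // s.card = t + 1} => f ∈ s.1)
    (by rw [card_sets_mem, Fintype.card_fin]; omega)
  -- The labels used for `f` in the messages that involve the demanded file `i` become the cached
  -- ones if `f ≠ i`, and the uncached ones if `f = i`.
  have hshift : ∀ i f : Fin N, ∃ σ : Equiv.Perm (Fin q),
      ((Finset.univ.filter fun s : {s : Finset (Fin N) // s.card = t + 1} =>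
        f ∈ s.1 ∧ i ∈ s.1).image (slot f)).image σ = if f = i then Aᶜ else A := fun i f =>
    exists_perm_image_eq <| by
      rw [Finset.card_image_of_injOn ((hslot f).mono fun s hs => by simp_all)]
      split_ifs with hfi
      · subst hfi
        simp only [and_self]
        rw [card_sets_mem, Finset.card_compl, hA, Fintype.card_fin, hq, Nat.add_sub_cancel]
      · rw [card_sets_mem_mem t hfi, hA]
  choose shift hshift using hshift
  refine ⟨⟨A, slot, shift, fun i f s hi hf hfi => ?_, fun i j hj => ?_⟩, hA⟩
  · have himage := hshift i f
    rw [if_neg hfi] at himage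
    rw [← himage]
    exact Finset.mem_image_of_mem _ (Finset.mem_image_of_mem _ (by simp [hi, hf]))
  · have himage := hshift i i
    rw [if_pos rfl] at himage
    rw [← Finset.mem_compl, ← himage, Finset.image_image] at hj
    obtain ⟨s, hs, hsj⟩ := Finset.mem_image.1 hj
    exact ⟨s, (Finset.mem_filter.1 hs).2.1, hsj⟩

theorem map_uniformOfFintype_perm {α : Type*} [Fintype α] [Nonempty α] (e : Equiv.Perm α) :
    (PMF.uniformOfFintype α).map e = PMF.uniformOfFintype α := by
  classical
  ext x
  rw [PMF.map_apply, tsum_eq_single (e.symm x)]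
  · simp [PMF.uniformOfFintype_apply]
  · intro y hy
    rw [if_neg fun hx => hy (by rw [hx, Equiv.symm_apply_apply])]

section OneWay

variable {N r q b B : ℕ}

/-- The position of bit `x` of piece `j` in a file. -/
def piecePos (h : q * b ≤ B) (j : Fin q) (x : Fin b) : Fin B :=
  Fin.castLE h (finProdFinEquiv (j, x))

/-- The bits that belong to no piece. -/
def unusedBits (h : q * b ≤ B) : Finset (Fin B) :=
  (Finset.univ.image (Fin.castLEEmb h))ᶜ

theorem card_unusedBits (h : q * b ≤ B) : (unusedBits h).card = B - q * b := by
  rw [unusedBits, Finset.card_compl, Finset.card_image_of_injective _ (Fin.castLEEmb h).injective]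
  simp

theorem exists_piecePos {h : q * b ≤ B} {y : Fin B} (hy : y ∉ unusedBits h) :
    ∃ j x, piecePos h j x = y := by
  rw [unusedBits, Finset.mem_compl, not_not] at hy
  obtain ⟨z, -, rfl⟩ := Finset.mem_image.1 hy
  exact ⟨(finProdFinEquiv.symm z).1, (finProdFinEquiv.symm z).2,
    congrArg (Fin.castLE h) (finProdFinEquiv.apply_symm_apply z)⟩

/-- The sum modulo two of one bit of each of the files in `s`. -/
def parity {ι : Type*} (s : Finset ι) (g : ι → Bool) : Bool :=
  decide (∑ f ∈ s, (if g f then (1 : ZMod 2) else 0) = 1)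

theorem eq_of_parity_eq {ι : Type*} {s : Finset ι} {g g' : ι → Bool} {i : ι} (hi : i ∈ s)
    (h : parity s g = parity s g') (hne : ∀ f ∈ s, f ≠ i → g f = g' f) : g i = g' i := by
  classical
  have hbit : ∀ x y : ZMod 2, (x = 1 ↔ y = 1) → x = y := by decide
  have hsum := hbit _ _ (decide_eq_decide.1 h)
  rw [← Finset.add_sum_erase _ _ hi, ← Finset.add_sum_erase _ _ hi,
    Finset.sum_congr rfl fun f hf => by
      rw [hne f (Finset.mem_of_mem_erase hf) (Finset.ne_of_mem_erase hf)]] at hsum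
  have hi' := add_right_cancel hsum
  cases hg : g i <;> cases hg' : g' i <;> simp [hg, hg'] at hi' ⊢

open Scheme

/-- User `u` caches a random selection of pieces of all files, and is served by the other user,
who caches the whole library. -/
def oneWay (D : Design N r q) (h : q * b ≤ B) (u : Fin 2) : Scheme 2 N B where
  CacheMeta _ := Fin N → Equiv.Perm (Fin q)
  PacketMeta _ := Fin N → Equiv.Perm (Fin q)
  placement := (PMF.uniformOfFintype (Fin N → Equiv.Perm (Fin q))).map
    fun τ k => if k = u then τ else 1
  content k τ F := if k = u then
      (Finset.univ : Finset (Fin N × D.cached × Fin b)).toList.map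
        fun y => F y.1 (piecePos h (τ y.1 y.2.1) y.2.2)
    else (Finset.univ : Finset (Fin N × Fin B)).toList.map fun x => F x.1 x.2
  query d c := PMF.pure fun k => if k = u then 1 else c u * D.shift (d u)
  payload k σ F := if k = u then [] else
    (Finset.univ : Finset ({s : Finset (Fin N) // s.card = r} × Fin b)).toList.map
      fun y => parity y.1.1 fun f => F f (piecePos h (σ f (D.slot f y.1)) y.2)

variable (D : Design N r q) (h : q * b ≤ B) {u v k : Fin 2}

variable (u) in
/-- The metadata of `oneWay` when user `u` demands file `i` and the pieces are permuted by `τ`. -/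
def oneWayMetadata (D : Design N r q) (h : q * b ≤ B) (i : Fin N)
    (τ : Fin N → Equiv.Perm (Fin q)) : (oneWay D h u).Metadata :=
  (fun k => if k = u then τ else (1 : Fin N → Equiv.Perm (Fin q)),
    fun k => if k = u then (1 : Fin N → Equiv.Perm (Fin q)) else τ * D.shift i)

theorem metaLaw_oneWay (d : Demands 2 N) : (oneWay D h u).metaLaw d =
    (PMF.uniformOfFintype (Fin N → Equiv.Perm (Fin q))).map (oneWayMetadata u D h (d u)) := by
  simp only [metaLaw, oneWay, PMF.bind_map, PMF.pure_map, Function.comp_def, if_true]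
  rfl

variable {D h}

theorem content_oneWay_self_eq_iff {i : Fin N} {τ : Fin N → Equiv.Perm (Fin q)}
    {F F' : Library N B} :
    (oneWay D h u).content u ((oneWayMetadata u D h i τ).1 u) F =
        (oneWay D h u).content u ((oneWayMetadata u D h i τ).1 u) F' ↔
      ∀ f, ∀ j ∈ D.cached, ∀ x, F f (piecePos h (τ f j) x) = F' f (piecePos h (τ f j) x) := by
  simp [oneWay, oneWayMetadata, List.map_inj_left]

theorem content_oneWay_other_eq_iff (hk : k ≠ u) {τ : Fin N → Equiv.Perm (Fin q)}
    {F F' : Library N B} :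
    (oneWay D h u).content k τ F = (oneWay D h u).content k τ F' ↔ F = F' := by
  simp [oneWay, hk, List.map_inj_left, funext_iff]

theorem payload_oneWay_eq_iff (hv : v ≠ u) {i : Fin N} {τ : Fin N → Equiv.Perm (Fin q)}
    {F F' : Library N B} :
    (oneWay D h u).payload v ((oneWayMetadata u D h i τ).2 v) F =
        (oneWay D h u).payload v ((oneWayMetadata u D h i τ).2 v) F' ↔
      ∀ (s : {s : Finset (Fin N) // s.card = r}) (x : Fin b),
        parity s.1 (fun f => F f (piecePos h (τ f (D.shift i f (D.slot f s))) x)) =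
          parity s.1 fun f => F' f (piecePos h (τ f (D.shift i f (D.slot f s))) x) := by
  simp [oneWay, oneWayMetadata, hv, List.map_inj_left]

theorem decode_oneWay (hv : v ≠ u) {i : Fin N} {τ : Fin N → Equiv.Perm (Fin q)}
    {F F' : Library N B}
    (hcontent : (oneWay D h u).content u ((oneWayMetadata u D h i τ).1 u) F =
      (oneWay D h u).content u ((oneWayMetadata u D h i τ).1 u) F')
    (hpayload : (oneWay D h u).payload v ((oneWayMetadata u D h i τ).2 v) F =
      (oneWay D h u).payload v ((oneWayMetadata u D h i τ).2 v) F')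
    {y : Fin B} (hy : y ∉ unusedBits h) : F i y = F' i y := by
  have hcached := content_oneWay_self_eq_iff.1 hcontent
  obtain ⟨j, x, rfl⟩ := exists_piecePos hy
  obtain ⟨l, rfl⟩ := (τ i).surjective j
  by_cases hl : l ∈ D.cached
  · exact hcached i l hl x
  · obtain ⟨s, hs, hsl⟩ := D.exists_of_notMem i l hl
    rw [← hsl]
    exact eq_of_parity_eq (i := i)
      (g := fun f => F f (piecePos h (τ f (D.shift i f (D.slot f s))) x))
      (g' := fun f => F' f (piecePos h (τ f (D.shift i f (D.slot f s))) x)) hs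
      ((payload_oneWay_eq_iff hv).1 hpayload s x)
      fun f hf hfi => hcached f _ (D.shift_mem i f s hs hf hfi) x

theorem map_view_oneWay_other (hk : k ≠ u) (d : Demands 2 N) :
    ((oneWay D h u).metaLaw d).map ((oneWay D h u).view k) =
      (PMF.uniformOfFintype (Fin N → Equiv.Perm (Fin q))).map fun σ =>
        ((1 : Fin N → Equiv.Perm (Fin q)),
          fun i : Fin 2 => if i = u then (1 : Fin N → Equiv.Perm (Fin q)) else σ) := by
  conv_rhs => rw [← map_uniformOfFintype_perm (Equiv.mulRight (D.shift (d u)))]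
  rw [metaLaw_oneWay, PMF.map_comp, PMF.map_comp]
  exact congrArg (PMF.map · _) (funext fun τ => Prod.ext (if_neg hk) rfl)

theorem isExact_oneWay (hv : v ≠ u) :
    (oneWay D h u).IsExact (fun k => if k = u then N * (D.cached.card * b) else N * B)
      (fun k => if k = u then 0 else N.choose r * b) (unusedBits h) where
  uncoded k c := by
    by_cases hk : k = u
    · refine ⟨(Finset.univ : Finset (Fin N × D.cached × Fin b)).toList.map
        fun y => (y.1, piecePos h (c y.1 y.2.1) y.2.2), fun F => ?_⟩
      simp [oneWay, hk, Function.comp_def]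
    · exact ⟨_, fun F => if_neg hk⟩
  content_length k c F := by
    by_cases hk : k = u <;> simp [oneWay, hk]
  payload_length k p F := by
    by_cases hk : k = u <;> simp [oneWay, hk]
  encode k d x _ F F' hF := by
    by_cases hk : k = u
    · simp [oneWay, hk]
    · rw [(content_oneWay_other_eq_iff hk).1 hF]
  decode k d x hx F F' hF hP y hy := by
    by_cases hk : k = u
    · subst hk
      rw [metaLaw_oneWay] at hx
      obtain ⟨τ, -, rfl⟩ := (PMF.mem_support_map_iff _ _ _).1 hx
      exact decode_oneWay hv hF (hP v) hy
    · rw [(content_oneWay_other_eq_iff hk).1 hF]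
  map_view_eq k d d' hd := by
    by_cases hk : k = u
    · subst hk
      simp only [metaLaw_oneWay, hd]
    · rw [map_view_oneWay_other hk, map_view_oneWay_other hk]

end OneWay

theorem natCast_mul_div_le (c B q : ℕ) : ((c * (B / q) : ℕ) : ℝ) ≤ B * (c / q : ℝ) := by
  rw [Nat.cast_mul, mul_div_left_comm]
  exact mul_le_mul_of_nonneg_left Nat.cast_div_le (Nat.cast_nonneg c)

theorem oneWay_mem_exactRegion {N r q : ℕ} (D : Design N r q) (hq : 0 < q) {u v : Fin 2}
    (hv : v ≠ u) :
    ((fun k => if k = u then (N : ℝ) * (D.cached.card / q) else N), (N.choose r : ℝ) / q) ∈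
      exactRegion 2 N := by
  let L := Real.logb 2 (Fintype.card (Fin N → Equiv.Perm (Fin q)))
  have hL : 0 ≤ L := Real.logb_nonneg one_lt_two (by exact_mod_cast Fintype.card_pos)
  refine ⟨2 * L + q, fun B => ⟨oneWay D (Nat.mul_div_le B q) u, _, _, _,
    isExact_oneWay hv, fun k => ?_, ?_, ?_⟩⟩
  · change L + _ ≤ _
    by_cases hk : k = u
    · have hpieces := mul_le_mul_of_nonneg_left (natCast_mul_div_le D.cached.card B q)
        (Nat.cast_nonneg (α := ℝ) N)
      simp only [hk, if_true, Nat.cast_mul N]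
      linarith
    · simp only [hk, if_false, Nat.cast_mul]
      linarith
  · have hpayload : ∑ k : Fin 2, ((if k = u then 0 else N.choose r * (B / q) : ℕ) : ℝ) =
        (N.choose r * (B / q) : ℕ) := by
      rw [Finset.sum_eq_single_of_mem v (Finset.mem_univ v) fun k _ hk => by
        rw [if_pos (by omega), Nat.cast_zero], if_neg hv]
    calc _ = ∑ k : Fin 2, (L + ((if k = u then 0 else N.choose r * (B / q) : ℕ) : ℝ)) := rfl
      _ = 2 * L + (N.choose r * (B / q) : ℕ) := by
          rw [Finset.sum_add_distrib, hpayload, Fin.sum_const, nsmul_eq_mul, Nat.cast_ofNat]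
      _ ≤ B * (N.choose r / q) + (2 * L + q) := by
          linarith [natCast_mul_div_le (N.choose r) B q]
  · have hcard : (unusedBits (Nat.mul_div_le B q)).card ≤ q := by
      rw [card_unusedBits, ← Nat.mod_eq_sub_mul_div]
      exact (Nat.mod_lt B hq).le
    have hcast : ((unusedBits (Nat.mul_div_le B q)).card : ℝ) ≤ q := by exact_mod_cast hcard
    linarith

section Corner

variable {N t : ℕ}

theorem natCast_choose_sub_choose (hN : 2 ≤ N) (ht : t < N) :
    (((N - 1).choose t - (N - 2).choose t : ℕ) : ℝ) = (N - 1).choose t * (t / (N - 1)) := by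
  obtain ⟨n, rfl⟩ := Nat.exists_eq_add_of_le' hN
  have hmul : (n.choose t : ℝ) * (n + 1) = (n + 1).choose t * (n + 1 - t) := by
    have hnat := congrArg (Nat.cast (R := ℝ)) (Nat.choose_mul_succ_eq n t)
    rwa [Nat.cast_mul, Nat.cast_mul, Nat.cast_sub (by omega), Nat.cast_succ] at hnat
  have hn : (((n + 2 : ℕ) : ℝ) - 1) = n + 1 := by push_cast; ring
  rw [Nat.add_sub_cancel, show n + 2 - 1 = n + 1 from rfl, hn,
    Nat.cast_sub (Nat.choose_le_choose t n.le_succ), mul_div_assoc', eq_div_iff (by positivity)]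
  linarith

theorem natCast_choose_succ (hN : 2 ≤ N) :
    (N.choose (t + 1) : ℝ) = (N - 1).choose t * (N / (t + 1)) := by
  obtain ⟨n, rfl⟩ := Nat.exists_eq_add_of_le' hN
  have hnat := congrArg (Nat.cast (R := ℝ)) (Nat.add_one_mul_choose_eq (n + 1) t)
  rw [Nat.cast_mul, Nat.cast_mul, Nat.cast_succ t] at hnat
  rw [mul_div_assoc', eq_div_iff (by positivity), ← hnat, mul_comm]
  rfl

theorem oneWay_corner_mem_exactRegion (hN : 2 ≤ N) (ht : t < N) {u v : Fin 2} (hv : v ≠ u) :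
    ((fun k => if k = u then (N : ℝ) * (t / (N + t - 1)) else N),
      (N : ℝ) * (N - 1) / ((t + 1) * (N + t - 1))) ∈ exactRegion 2 N := by
  obtain ⟨D, hD⟩ := exists_design ht
  have hC : 0 < (N - 1).choose t := Nat.choose_pos (by omega)
  have hC' : (0 : ℝ) < (N - 1).choose t := by exact_mod_cast hC
  have hN' : (0 : ℝ) < N - 1 := sub_pos.2 (by exact_mod_cast hN)
  have hNt : (0 : ℝ) < N + t - 1 := by linarith [Nat.cast_nonneg (α := ℝ) t]
  have hq : (((N - 1).choose t + ((N - 1).choose t - (N - 2).choose t) : ℕ) : ℝ) =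
      (N - 1).choose t * ((N + t - 1) / (N - 1)) := by
    rw [Nat.cast_add, natCast_choose_sub_choose hN ht]
    field_simp
    ring
  have hmem := oneWay_mem_exactRegion D (Nat.add_pos_left hC _) hv
  rw [hD, hq, natCast_choose_sub_choose hN ht, natCast_choose_succ hN] at hmem
  convert hmem using 2
  · field_simp
  · field_simp

/-- The memory-load pair of Scheme B with parameter `t`. -/
def schemeBCorner (N t : ℕ) : ℝ × ℝ :=
  ((N : ℝ) / 2 + (N : ℝ) * t / (2 * ((N : ℝ) + t - 1)),
    (N : ℝ) * ((N : ℝ) - 1) / (((t : ℝ) + 1) * ((N : ℝ) + t - 1)))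

theorem schemeBCorner_mem_exactRegion (hN : 2 ≤ N) (ht : t < N) :
    ((fun _ => (schemeBCorner N t).1), (schemeBCorner N t).2) ∈ exactRegion 2 N := by
  have hmid := convex_exactRegion 2 N
    (oneWay_corner_mem_exactRegion hN ht (u := 0) (v := 1) (by decide))
    (oneWay_corner_mem_exactRegion hN ht (u := 1) (v := 0) (by decide))
    (one_half_pos (α := ℝ)).le (one_half_pos (α := ℝ)).le (add_halves 1)
  have hNt : (N : ℝ) * t / (2 * (N + t - 1)) = 1 / 2 * (N * (t / (N + t - 1))) := by
    rw [mul_comm 2, ← div_div]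
    ring
  convert hmid using 1
  refine Prod.ext (funext fun k => ?_) ?_
  · fin_cases k <;> simp [schemeBCorner, hNt] <;> ring
  · simp only [schemeBCorner, Prod.snd_add, Prod.smul_snd, smul_eq_mul]
    ring

end Corner

section SchemeB

variable {N t : ℕ} {M R : ℝ}

theorem schemeBCorner_mem_hull (ht : t < N) :
    schemeBCorner N t ∈ convexHull ℝ (schemeBPoints N) :=
  subset_convexHull ℝ _ (Set.mem_insert_of_mem _ ⟨t, ht, rfl⟩)

theorem full_mem_hull (N : ℕ) : ((N : ℝ), (0 : ℝ)) ∈ convexHull ℝ (schemeBPoints N) :=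
  subset_convexHull ℝ _ (Set.mem_insert _ _)

theorem mem_exactRegion_of_mem_hull (hN : 2 ≤ N) (h : (M, R) ∈ convexHull ℝ (schemeBPoints N)) :
    ((fun _ => M), R) ∈ exactRegion 2 N := by
  have hconv : Convex ℝ {x : ℝ × ℝ | ((fun _ => x.1 : Fin 2 → ℝ), x.2) ∈ exactRegion 2 N} :=
    fun x hx y hy a b ha hb hab => convex_exactRegion 2 N hx hy ha hb hab
  refine convexHull_min ?_ hconv h
  rintro x (rfl | ⟨t, ht, rfl⟩)
  · exact fullCache_mem_exactRegion 2 N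
  · exact schemeBCorner_mem_exactRegion hN ht

theorem nonneg_of_mem_hull (hN : 2 ≤ N) (h : (M, R) ∈ convexHull ℝ (schemeBPoints N)) :
    0 ≤ R := by
  have hconv : Convex ℝ {x : ℝ × ℝ | 0 ≤ x.2} := fun x hx y hy a b ha hb _ =>
    add_nonneg (mul_nonneg ha hx) (mul_nonneg hb hy)
  refine convexHull_min ?_ hconv h
  have hN' : (2 : ℝ) ≤ N := by exact_mod_cast hN
  rintro x (rfl | ⟨t, -, rfl⟩)
  · exact le_refl (0 : ℝ)
  · change 0 ≤ (N : ℝ) * (N - 1) / ((t + 1) * (N + t - 1))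
    have hden : 0 < (N : ℝ) + t - 1 := by linarith [Nat.cast_nonneg (α := ℝ) t]
    exact div_nonneg (mul_nonneg (Nat.cast_nonneg N) (by linarith)) (by positivity)

theorem schemeBLoad_le_of_mem_hull (hN : 2 ≤ N) (h : (M, R) ∈ convexHull ℝ (schemeBPoints N)) :
    schemeBLoad N M ≤ R :=
  csInf_le ⟨0, fun _ hR => nonneg_of_mem_hull hN hR⟩ h

theorem schemeBLoad_nonneg (hN : 2 ≤ N) : 0 ≤ schemeBLoad N M :=
  Real.sInf_nonneg fun _ hR => nonneg_of_mem_hull hN hR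

theorem exists_mem_le_of_line {s : Set (ℝ × ℝ)} (hs : Convex ℝ s) {p q : ℝ × ℝ} (hp : p ∈ s)
    (hq : q ∈ s) (hpM : p.1 ≤ M) (hMq : M ≤ q.1) {α β : ℝ} (hpR : p.2 ≤ α * p.1 + β)
    (hqR : q.2 ≤ α * q.1 + β) : ∃ R ≤ α * M + β, (M, R) ∈ s := by
  have hM : M ∈ segment ℝ p.1 q.1 := by
    rw [segment_eq_Icc (hpM.trans hMq)]
    exact ⟨hpM, hMq⟩
  obtain ⟨a, b, ha, hb, hab, rfl⟩ := hM
  refine ⟨a * p.2 + b * q.2, ?_, hs hp hq ha hb hab⟩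
  calc a * p.2 + b * q.2 ≤ a * (α * p.1 + β) + b * (α * q.1 + β) := by gcongr
    _ = α * (a * p.1 + b * q.1) + (a + b) * β := by ring
    _ = α * (a • p.1 + b • q.1) + β := by rw [hab, one_mul, smul_eq_mul, smul_eq_mul]

theorem schemeBLoad_le_of_line (hN : 2 ≤ N) {p q : ℝ × ℝ}
    (hp : p ∈ convexHull ℝ (schemeBPoints N)) (hq : q ∈ convexHull ℝ (schemeBPoints N))
    (hpM : p.1 ≤ M) (hMq : M ≤ q.1) {α β : ℝ} (hpR : p.2 ≤ α * p.1 + β)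
    (hqR : q.2 ≤ α * q.1 + β) : schemeBLoad N M ≤ α * M + β := by
  obtain ⟨R, hR, hmem⟩ :=
    exists_mem_le_of_line (convex_convexHull ℝ _) hp hq hpM hMq hpR hqR
  exact (schemeBLoad_le_of_mem_hull hN hmem).trans hR

theorem schemeBCorner_zero (hN : 2 ≤ N) : schemeBCorner N 0 = ((N : ℝ) / 2, (N : ℝ)) := by
  have hN1 : (N : ℝ) - 1 ≠ 0 := (sub_pos.2 (by exact_mod_cast hN)).ne'
  ext
  · simp [schemeBCorner]
  · simp [schemeBCorner, hN1]

theorem schemeBCorner_one (hN : 2 ≤ N) :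
    schemeBCorner N 1 = (((N : ℝ) + 1) / 2, ((N : ℝ) - 1) / 2) := by
  have hN0 : (N : ℝ) ≠ 0 := by positivity
  simp only [schemeBCorner, Nat.cast_one, add_sub_cancel_right]
  ext <;> field_simp
  norm_num

theorem schemeBCorner_sub_one (hN : 2 ≤ N) :
    schemeBCorner N (N - 1) = (3 * (N : ℝ) / 4, 1 / 2) := by
  have hN1 : (N : ℝ) - 1 ≠ 0 := (sub_pos.2 (by exact_mod_cast hN)).ne'
  simp only [schemeBCorner]
  rw [Nat.cast_sub (by omega), Nat.cast_one,
    show (N : ℝ) + (N - 1) - 1 = 2 * (N - 1) by ring, sub_add_cancel]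
  ext
  · field_simp
    norm_num
  · field_simp

theorem schemeBCorner_sub_two (hN : 2 ≤ N) :
    schemeBCorner N (N - 2) =
      ((N : ℝ) * (3 * N - 5) / (2 * (2 * N - 3)), (N : ℝ) / (2 * N - 3)) := by
  have hN' : (2 : ℝ) ≤ N := by exact_mod_cast hN
  have hN1 : (N : ℝ) - 1 ≠ 0 := by linarith
  have hN3 : 2 * (N : ℝ) - 3 ≠ 0 := by linarith
  simp only [schemeBCorner]
  rw [Nat.cast_sub hN, Nat.cast_ofNat,
    show (N : ℝ) + (N - 2) - 1 = 2 * N - 3 by ring, show (N : ℝ) - 2 + 1 = N - 1 by ring]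
  ext
  · rw [div_add_div _ _ two_ne_zero (mul_ne_zero two_ne_zero hN3),
      div_eq_div_iff (by positivity) (mul_ne_zero two_ne_zero hN3)]
    ring
  · rw [mul_comm (N : ℝ) (N - 1), mul_div_mul_left _ _ hN1]

/-- The lower convex envelope is attained because the convex hull of the points is compact. -/
theorem schemeBLoad_mem_hull (hN : 2 ≤ N) (hM : (N : ℝ) / 2 ≤ M) (hMN : M ≤ N) :
    (M, schemeBLoad N M) ∈ convexHull ℝ (schemeBPoints N) := by
  have hcompact : IsCompact (convexHull ℝ (schemeBPoints N)) :=
    (((Set.finite_Iio N).image _).insert _).isCompact_convexHull ℝ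
  have hclosed : IsClosed {R : ℝ | (M, R) ∈ convexHull ℝ (schemeBPoints N)} :=
    hcompact.isClosed.preimage (by fun_prop : Continuous fun R : ℝ => (M, R))
  have hzero : ((N : ℝ) / 2, (N : ℝ)) ∈ convexHull ℝ (schemeBPoints N) :=
    schemeBCorner_zero hN ▸ schemeBCorner_mem_hull (by omega)
  obtain ⟨R, -, hR⟩ := exists_mem_le_of_line (convex_convexHull ℝ _) hzero (full_mem_hull N) hM hMN
    (α := 0) (β := N) (by simp) (by simp)
  exact hclosed.csInf_mem ⟨R, hR⟩ ⟨0, fun _ hR => nonneg_of_mem_hull hN hR⟩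

theorem achievableUncoded_schemeBLoad (hN : 2 ≤ N) (dl : PMF (Demands 2 N))
    (hM : (N : ℝ) / 2 ≤ M) (hMN : M ≤ N) : AchievableUncoded dl M (schemeBLoad N M) :=
  achievableUncoded_of_mem_exactRegion dl
    (mem_exactRegion_of_mem_hull hN (schemeBLoad_mem_hull hN hM hMN))

theorem schemeBLoad_le_converseBound_self (hN : 2 ≤ N) (hM : (N : ℝ) / 2 ≤ M)
    (hM' : M ≤ ((N : ℝ) + 1) / 2) : schemeBLoad N M ≤ converseBound N N M := by
  have hN0 : (N : ℝ) ≠ 0 := by positivity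
  have hline : converseBound N N M = -(N + 1) * M + N * (N + 3) / 2 := by
    rw [converseBound]
    field_simp
    ring
  rw [hline]
  refine schemeBLoad_le_of_line hN (schemeBCorner_zero hN ▸ schemeBCorner_mem_hull (by omega))
    (schemeBCorner_one hN ▸ schemeBCorner_mem_hull (by omega)) hM hM' (le_of_eq ?_) (le_of_eq ?_)
  · ring
  · ring

theorem schemeBLoad_le_converseBound_one (hN : 2 ≤ N) (hM : 3 * (N : ℝ) / 4 ≤ M) (hMN : M ≤ N) :
    schemeBLoad N M ≤ converseBound N 1 M := by
  have hN0 : (N : ℝ) ≠ 0 := by positivity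
  have hline : converseBound N 1 M = -(2 / N) * M + 2 := by
    rw [converseBound]
    push_cast
    ring
  rw [hline]
  refine schemeBLoad_le_of_line hN
    (schemeBCorner_sub_one hN ▸ schemeBCorner_mem_hull (by omega)) (full_mem_hull N) hM hMN
    (le_of_eq ?_) (le_of_eq ?_)
  · field_simp
    norm_num
  · field_simp
    norm_num

theorem schemeBLoad_le_converseBound_two (hN : 2 ≤ N)
    (hM : (N : ℝ) * (3 * N - 5) / (2 * (2 * N - 3)) ≤ M) (hM' : M ≤ 3 * (N : ℝ) / 4) :
    schemeBLoad N M ≤ converseBound N 2 M := by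
  have hN' : (2 : ℝ) ≤ N := by exact_mod_cast hN
  have hN0 : (N : ℝ) ≠ 0 := by positivity
  have hN3 : 2 * (N : ℝ) - 3 ≠ 0 := by linarith
  have hline : converseBound N 2 M = -(6 / N) * M + 5 := by
    rw [converseBound]
    push_cast
    ring
  rw [hline]
  refine schemeBLoad_le_of_line hN
    (schemeBCorner_sub_two hN ▸ schemeBCorner_mem_hull (by omega))
    (schemeBCorner_sub_one hN ▸ schemeBCorner_mem_hull (by omega)) hM hM'
    (le_of_eq ?_) (le_of_eq ?_)
  · have hcancel : 6 / (N : ℝ) * (N * (3 * N - 5) / (2 * (2 * N - 3))) =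
        3 * (3 * N - 5) / (2 * N - 3) := by
      field_simp
      ring
    rw [neg_mul, hcancel, eq_neg_add_iff_add_eq, ← add_div, div_eq_iff hN3]
    ring
  · field_simp
    norm_num

/-- The cache size at which the lower bounds `converseBound N (k - 1)` and `converseBound N k`
cross. -/
def crossing (N k : ℕ) : ℝ :=
  (N : ℝ) / 2 + N / (2 * k)

theorem half_le_crossing (N k : ℕ) : (N : ℝ) / 2 ≤ crossing N k :=
  le_add_of_nonneg_right (by positivity)

theorem crossing_le {k : ℕ} (hk : 1 ≤ k) : crossing N k ≤ N := by
  have hk' : (1 : ℝ) ≤ k := by exact_mod_cast hk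
  calc crossing N k ≤ (N : ℝ) / 2 + N / (2 * 1) := by
        unfold crossing
        gcongr
    _ = N := by ring

theorem crossing_one (N : ℕ) : crossing N 1 = N := by
  rw [crossing, Nat.cast_one]
  ring

theorem converseBound_crossing_succ {n : ℕ} (hN : 0 < N) :
    converseBound N n (crossing N (n + 1)) = n / 2 := by
  have hN' : (N : ℝ) ≠ 0 := by positivity
  rw [converseBound, crossing, Nat.cast_succ]
  field_simp
  ring

theorem converseBound_crossing_self {n : ℕ} (hN : 0 < N) (hn : 1 ≤ n) :
    converseBound N n (crossing N n) = (n - 1) / 2 := by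
  have hN' : (N : ℝ) ≠ 0 := by positivity
  have hn' : (n : ℝ) ≠ 0 := by positivity
  rw [converseBound, crossing]
  field_simp
  ring

theorem schemeBCorner_fst_le {k : ℕ} (ht : 1 ≤ t) (hk : 1 ≤ k)
    (htk : (t : ℝ) * (k - 1) ≤ N - 1) : (schemeBCorner N t).1 ≤ crossing N k := by
  have hk' : (1 : ℝ) ≤ k := by exact_mod_cast hk
  have ht' : (1 : ℝ) ≤ t := by exact_mod_cast ht
  have hN : (1 : ℝ) ≤ N := by
    linarith [mul_nonneg (zero_le_one.trans ht') (sub_nonneg.2 hk')]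
  have hfrac : (N : ℝ) * t / (2 * (N + t - 1)) ≤ N / (2 * k) := by
    rw [div_le_div_iff₀ (by linarith) (by linarith)]
    calc (N : ℝ) * t * (2 * k) = N * (2 * (t * (k - 1) + t)) := by ring
      _ ≤ N * (2 * (N + t - 1)) := by gcongr; linarith
  exact add_le_add_right hfrac _

theorem schemeBCorner_snd_le {k : ℝ} (ht : 1 ≤ t) (htk : (N : ℝ) - 1 ≤ (t + 1) * (k - 1))
    (hN : 0 < N) (hk : 1 ≤ k) : (schemeBCorner N t).2 ≤ k - 1 := by
  have ht' : (1 : ℝ) ≤ t := by exact_mod_cast ht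
  have hN' : (0 : ℝ) < N := by exact_mod_cast hN
  rw [schemeBCorner, div_le_iff₀ (mul_pos (by linarith) (by linarith))]
  calc (N : ℝ) * (N - 1) ≤ N * ((t + 1) * (k - 1)) := mul_le_mul_of_nonneg_left htk hN'.le
    _ ≤ (N + t - 1) * ((t + 1) * (k - 1)) :=
        mul_le_mul_of_nonneg_right (by linarith) (mul_nonneg (by linarith) (sub_nonneg.2 hk))
    _ = (k - 1) * ((t + 1) * (N + t - 1)) := by ring

theorem schemeBLoad_crossing_le {k : ℕ} (hN : 2 ≤ N) (hk : 1 ≤ k) (hkN : k ≤ N) :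
    schemeBLoad N (crossing N k) ≤ k - 1 := by
  rcases hk.eq_or_lt with rfl | hk
  · rw [crossing_one, Nat.cast_one, sub_self]
    exact schemeBLoad_le_of_mem_hull hN (full_mem_hull N)
  have hk' : (2 : ℝ) ≤ k := by exact_mod_cast hk
  have hkN' : (k : ℝ) ≤ N := by exact_mod_cast hkN
  have hk0 : (0 : ℝ) < k - 1 := by linarith
  have hquot : 0 ≤ ((N : ℝ) - 1) / (k - 1) := div_nonneg (by linarith) hk0.le
  obtain ⟨t, ht⟩ : ∃ t, t = ⌊((N : ℝ) - 1) / (k - 1)⌋₊ := ⟨_, rfl⟩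
  have htk : (t : ℝ) * (k - 1) ≤ N - 1 := (le_div_iff₀ hk0).1 (ht ▸ Nat.floor_le hquot)
  have hkt : (N : ℝ) - 1 ≤ (t + 1) * (k - 1) :=
    ((div_lt_iff₀ hk0).1 (ht ▸ Nat.lt_floor_add_one _)).le
  have ht1 : 1 ≤ t := ht ▸ Nat.le_floor (by
    rw [Nat.cast_one, one_le_div hk0]
    linarith)
  have htN : t < N := by
    have hle : (t : ℝ) ≤ t * (k - 1) := le_mul_of_one_le_right (Nat.cast_nonneg t) (by linarith)
    exact_mod_cast (hle.trans htk).trans_lt (sub_one_lt _)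
  have hcorner := schemeBCorner_snd_le ht1 hkt (by omega) (by linarith)
  have hline := schemeBLoad_le_of_line hN (schemeBCorner_mem_hull htN) (full_mem_hull N)
    (schemeBCorner_fst_le ht1 (by omega) htk) (crossing_le (by omega)) (α := 0) (β := (k : ℝ) - 1)
    (by linarith) (by linarith)
  linarith

theorem exists_crossing_le_le (hM : ((N : ℝ) + 1) / 2 < M) (hMN : M ≤ N) :
    ∃ n : ℕ, 1 ≤ n ∧ n < N ∧ crossing N (n + 1) ≤ M ∧ M ≤ crossing N n := by
  have hd : 0 < 2 * M - N := by linarith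
  have hN : (1 : ℝ) < N := by linarith
  have hquot : 0 ≤ N / (2 * M - N) := by positivity
  obtain ⟨n, hn⟩ : ∃ n, n = ⌊N / (2 * M - N)⌋₊ := ⟨_, rfl⟩
  have hle : n * (2 * M - N) ≤ N := (le_div_iff₀ hd).1 (hn ▸ Nat.floor_le hquot)
  have hlt : N < (n + 1) * (2 * M - N) := (div_lt_iff₀ hd).1 (hn ▸ Nat.lt_floor_add_one _)
  have hn1 : 1 ≤ n := hn ▸ Nat.le_floor (by
    rw [Nat.cast_one, one_le_div hd]
    linarith)
  have hnN : n < N := hn ▸ (Nat.floor_lt hquot).2 (by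
    rw [div_lt_iff₀ hd]
    exact lt_mul_of_one_lt_right (by linarith) (by linarith))
  have hn0 : (0 : ℝ) < n := by exact_mod_cast hn1
  refine ⟨n, hn1, hnN, ?_, ?_⟩
  · have hdiv : N / ((n : ℝ) + 1) ≤ 2 * M - N := (div_le_iff₀' (by linarith)).2 hlt.le
    rw [crossing, mul_comm 2, ← div_div, Nat.cast_succ]
    linarith
  · have hdiv : 2 * M - N ≤ N / (n : ℝ) := (le_div_iff₀' hn0).2 hle
    rw [crossing, mul_comm 2, ← div_div]
    linarith

theorem exists_schemeBLoad_le_two_mul_converseBound (hN : 2 ≤ N) (hM : (N : ℝ) / 2 ≤ M)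
    (hMN : M ≤ N) : ∃ n ≤ N, schemeBLoad N M ≤ 2 * converseBound N n M := by
  rcases le_or_gt M (((N : ℝ) + 1) / 2) with hfirst | hfirst
  · have hle := schemeBLoad_le_converseBound_self hN hM hfirst
    exact ⟨N, le_rfl, by linarith [schemeBLoad_nonneg (M := M) hN]⟩
  obtain ⟨n, hn, hnN, hMn, hnM⟩ := exists_crossing_le_le hfirst hMN
  have hline : ∀ x : ℝ,
      2 * converseBound N n x = -(2 * (n * (n + 1) / N)) * x + n * (n + 3) := fun x => by
    rw [converseBound]
    ring
  refine ⟨n, hnN.le, hline M ▸ schemeBLoad_le_of_line hN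
    (schemeBLoad_mem_hull hN (half_le_crossing N (n + 1)) (crossing_le n.succ_pos))
    (schemeBLoad_mem_hull hN (half_le_crossing N n) (crossing_le hn)) hMn hnM ?_ ?_⟩
  · rw [← hline, converseBound_crossing_succ (by omega)]
    refine (schemeBLoad_crossing_le hN n.succ_pos hnN).trans_eq ?_
    rw [Nat.cast_succ]
    ring
  · rw [← hline, converseBound_crossing_self (by omega) hn]
    exact (schemeBLoad_crossing_le hN hn hnN.le).trans_eq (by ring)

section Optimality

variable {dl : PMF (Demands 2 N)}

theorem isLeast_schemeBLoad (hN : 2 ≤ N) (hfull : ∀ d, dl d ≠ 0) (hM : (N : ℝ) / 2 ≤ M)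
    (hMN : M ≤ N) {n : ℕ} (hn : n ≤ N) (hle : schemeBLoad N M ≤ converseBound N n M) :
    IsLeast {R : ℝ | AchievableUncoded dl M R} (schemeBLoad N M) :=
  ⟨achievableUncoded_schemeBLoad hN dl hM hMN,
    fun _ hR => hle.trans (hR.converseBound_le hfull (by omega) hn)⟩

theorem isLeast_schemeBLoad_of_le (hN : 2 ≤ N) (hfull : ∀ d, dl d ≠ 0) (hM : (N : ℝ) / 2 ≤ M)
    (hM' : M ≤ ((N : ℝ) + 1) / 2) :
    IsLeast {R : ℝ | AchievableUncoded dl M R} (schemeBLoad N M) := by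
  have hN' : (2 : ℝ) ≤ N := by exact_mod_cast hN
  exact isLeast_schemeBLoad hN hfull hM (by linarith) le_rfl
    (schemeBLoad_le_converseBound_self hN hM hM')

theorem isLeast_schemeBLoad_of_ge (hN : 2 ≤ N) (hfull : ∀ d, dl d ≠ 0)
    (hM : (N : ℝ) * (3 * N - 5) / (2 * (2 * N - 3)) ≤ M) (hMN : M ≤ N) :
    IsLeast {R : ℝ | AchievableUncoded dl M R} (schemeBLoad N M) := by
  have hN' : (2 : ℝ) ≤ N := by exact_mod_cast hN
  have hhalf : (N : ℝ) / 2 ≤ N * (3 * N - 5) / (2 * (2 * N - 3)) := by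
    rw [mul_div_mul_comm]
    exact le_mul_of_one_le_right (by positivity) ((one_le_div (by linarith)).2 (by linarith))
  rcases le_total M (3 * (N : ℝ) / 4) with hM' | hM'
  · exact isLeast_schemeBLoad hN hfull (hhalf.trans hM) hMN hN
      (schemeBLoad_le_converseBound_two hN hM hM')
  · exact isLeast_schemeBLoad hN hfull (hhalf.trans hM) hMN (by omega)
      (schemeBLoad_le_converseBound_one hN hM' hMN)

theorem AchievableUncoded.schemeBLoad_le_two_mul (h : AchievableUncoded dl M R) (hN : 2 ≤ N)
    (hfull : ∀ d, dl d ≠ 0) (hM : (N : ℝ) / 2 ≤ M) (hMN : M ≤ N) :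
    schemeBLoad N M ≤ 2 * R := by
  obtain ⟨n, hn, hle⟩ := exists_schemeBLoad_le_two_mul_converseBound hN hM hMN
  exact hle.trans (mul_le_mul_of_nonneg_left (h.converseBound_le hfull (by omega) hn) zero_le_two)

end Optimality

end SchemeB

end

end D2DPrivateCaching

theorem theorem4_general (N : ℕ) (hN : 2 ≤ N)
    (demandLaw : PMF (D2DPrivateCaching.Demands 2 N)) (hfull : ∀ d, demandLaw d ≠ 0) :
    (∀ M : ℝ,
      (((N : ℝ) / 2 ≤ M ∧ M ≤ ((N : ℝ) + 1) / 2) ∨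
        ((N : ℝ) * (3 * N - 5) / (2 * (2 * N - 3)) ≤ M ∧ M ≤ N)) →
      IsLeast {R : ℝ | D2DPrivateCaching.AchievableUncoded demandLaw M R}
        (D2DPrivateCaching.schemeBLoad N M)) ∧
    (∀ M : ℝ, (N : ℝ) / 2 ≤ M → M ≤ N →
      D2DPrivateCaching.AchievableUncoded demandLaw M (D2DPrivateCaching.schemeBLoad N M) ∧
      ∀ R : ℝ, D2DPrivateCaching.AchievableUncoded demandLaw M R →
        D2DPrivateCaching.schemeBLoad N M ≤ 2 * R) := by
  refine ⟨fun M hM => ?_, fun M hM hMN => ⟨?_, fun R hR => ?_⟩⟩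
  · rcases hM with ⟨hM, hM'⟩ | ⟨hM, hMN⟩
    · exact D2DPrivateCaching.isLeast_schemeBLoad_of_le hN hfull hM hM'
    · exact D2DPrivateCaching.isLeast_schemeBLoad_of_ge hN hfull hM hMN
  · exact D2DPrivateCaching.achievableUncoded_schemeBLoad hN demandLaw hM hMN
  · exact hR.schemeBLoad_le_two_mul hN hfull hM hMN

theorem theorem4 (N : ℕ) (hN : 2 ≤ N)
    (demandLaw : PMF (D2DPrivateCaching.Demands 2 N)) (hfull : ∀ d, demandLaw d ≠ 0) :
    (∀ M : ℝ,
      (((N : ℝ) / 2 ≤ M ∧ M ≤ ((N : ℝ) + 1) / 2) ∨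
        ((N : ℝ) * (3 * N - 5) / (2 * (2 * N - 3)) ≤ M ∧ M ≤ N)) →
      IsLeast {R : ℝ | D2DPrivateCaching.AchievableUncoded demandLaw M R}
        (D2DPrivateCaching.schemeBLoad N M)) ∧
    (∀ M : ℝ, (N : ℝ) / 2 ≤ M → M ≤ N →
      D2DPrivateCaching.AchievableUncoded demandLaw M (D2DPrivateCaching.schemeBLoad N M) ∧
      ∀ R : ℝ, D2DPrivateCaching.AchievableUncoded demandLaw M R →
        D2DPrivateCaching.schemeBLoad N M ≤ 3 * R) := by
  refine (theorem4_general N hN demandLaw hfull).imp_right fun h M hM hMN =>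
    (h M hM hMN).imp_right fun hle R hR => ?_
  linarith [hle R hR, D2DPrivateCaching.schemeBLoad_nonneg (M := M) hN]
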